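/- Let $n\ge 2$ and let $B_n$ be the $n$-string braid group, given by Artin's presentation with generators $\sigma_1,\dots,\sigma_{n-1}$ and relations $\sigma_t\sigma_s=\sigma_s\sigma_t$ for $|t-s|>1$ and $\sigma_t\sigma_s\sigma_t=\sigma_s\sigma_t\sigma_s$ for $|t-s|=1$. For $n\ge t>s\ge 1$ let $$a_{ts}=(\sigma_{t-1}\sigma_{t-2}\cdots\sigma_{s+1})\,\sigma_s\,(\sigma_{t-1}\sigma_{t-2}\cdots\sigma_{s+1})^{-1}$$ be the band generators, let $\delta=a_{n(n-1)}a_{(n-1)(n-2)}\cdots a_{21}$, and let $B_n^+\subset B_n$ be the monoid of positive braids, i.e. the submonoid generated by all the $a_{ts}$. The length $|P|$ of $P\in B_n^+$ is the number of letters of any word in the $a_{ts}$ (with positive exponents only) representing $P$; it does not depend on the word. For $V,W\in B_n$ write $V\le W$ if $W=P_1VP_2$ for some $P_1,P_2\in B_n^+$, and $V<W$ if moreover $V\ne W$; let $e$ be the identity. Put $$\inf(W)=\max\{u\in\mathbb Z: \delta^u\le W\},\qquad \sup(W)=\min\{v\in\mathbb Z: W\le\delta^v\}.$$ If $e\le A\le\delta$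 and $e\le P$, the pair $AP$ is called left-weighted if $|A'|\le|A|$ for all braids $A',P'$ with $e\le A'\le\delta$, $e\le P'$ and $A'P'=AP$. Theorem (left-canonical form). For every $W\in B_n$ there are a unique integer $u$ and a unique finite (possibly empty) sequence $A_1,\dots,A_k$ of braids such that $$W=\delta^uA_1A_2\cdots A_k,\qquad e<A_i<\delta\ \ (1\le i\le k),\qquad A_iA_{i+1}\text{ is left-weighted}\ \ (1\le i<k).$$ Moreover, the maximum and the minimum defining $\inf(W)$ and $\sup(W)$ exist, and $\inf(W)=u$ and $\sup(W)=u+k$. -/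

import Mathlib

namespace BandBraid

/-- Indices of the Artin generators of the `n`-string braid group: `1 ≤ i ≤ n - 1`. -/
abbrev ArtinIndex (n : ℕ) : Type := {i : ℕ // 1 ≤ i ∧ i < n}

/-- The relators of Artin's presentation: `σ_t σ_s = σ_s σ_t` for `|t - s| > 1` and
`σ_t σ_s σ_t = σ_s σ_t σ_s` for `|t - s| = 1`. -/
def artinRelators (n : ℕ) : Set (FreeGroup (ArtinIndex n)) :=
  {r | ∃ t s : ArtinIndex n, 1 < |(t.1 : ℤ) - (s.1 : ℤ)| ∧
      r = (FreeGroup.of t * FreeGroup.of s) * (FreeGroup.of s * FreeGroup.of t)⁻¹} ∪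
  {r | ∃ t s : ArtinIndex n, |(t.1 : ℤ) - (s.1 : ℤ)| = 1 ∧
      r = (FreeGroup.of t * FreeGroup.of s * FreeGroup.of t) *
        (FreeGroup.of s * FreeGroup.of t * FreeGroup.of s)⁻¹}

/-- The `n`-string braid group `B_n`. -/
abbrev Braid (n : ℕ) : Type := PresentedGroup (artinRelators n)

/-- The Artin generator `σ_i`, for `1 ≤ i ≤ n - 1` (the value at other `i` is never used). -/
def sigma (n i : ℕ) : Braid n :=
  if h : 1 ≤ i ∧ i < n then PresentedGroup.of ⟨i, h⟩ else 1

/-- The descending product `σ_{t-1} σ_{t-2} ⋯ σ_s` (empty if `t ≤ s`). -/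
def sigmaDesc (n t s : ℕ) : Braid n := ((List.Ico s t).reverse.map (sigma n)).prod

/-- The band generator
`a_{ts} = (σ_{t-1} ⋯ σ_{s+1}) σ_s (σ_{t-1} ⋯ σ_{s+1})⁻¹`, used for `n ≥ t > s ≥ 1`. -/
def band (n t s : ℕ) : Braid n :=
  sigmaDesc n t (s + 1) * sigma n s * (sigmaDesc n t (s + 1))⁻¹

/-- The fundamental braid `δ = a_{n(n-1)} a_{(n-1)(n-2)} ⋯ a_{21}`. -/
def delta (n : ℕ) : Braid n := ((List.Ico 1 n).reverse.map fun i => band n (i + 1) i).prod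

/-- Index pairs `(t, s)` with `n ≥ t > s ≥ 1`. -/
abbrev BandIndex (n : ℕ) : Type := {p : ℕ × ℕ // 1 ≤ p.2 ∧ p.2 < p.1 ∧ p.1 ≤ n}

/-- A positive word: a word in positive powers of the band generators. -/
abbrev PosWord (n : ℕ) : Type := List (BandIndex n)

/-- The braid represented by a positive word. -/
def evalWord {n : ℕ} (w : PosWord n) : Braid n := (w.map fun p => band n p.1.1 p.1.2).prod

/-- The monoid `B_n⁺ ⊆ B_n` of positive braids, generated by the band generators. -/
def positive (n : ℕ) : Submonoid (Braid n) :=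
  Submonoid.closure (Set.range fun p : BandIndex n => band n p.1.1 p.1.2)

/-- `V ≤ W`, that is, `W = P₁ V P₂` with `P₁, P₂ ∈ B_n⁺`. -/
def Le {n : ℕ} (V W : Braid n) : Prop :=
  ∃ P₁ ∈ positive n, ∃ P₂ ∈ positive n, W = P₁ * V * P₂

/-- `V < W`, that is, `V ≤ W` and `V ≠ W`. -/
def Lt {n : ℕ} (V W : Braid n) : Prop := Le V W ∧ V ≠ W

/-- `A ∈ [0, 1]`, that is, `e ≤ A ≤ δ`. -/
def InUnitInterval {n : ℕ} (A : Braid n) : Prop := Le 1 A ∧ Le A (delta n)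

/-- A canonical factor in a canonical form: a braid strictly between `e` and `δ`. -/
def IsCanonicalFactor {n : ℕ} (A : Braid n) : Prop := Lt 1 A ∧ Lt A (delta n)

/-- The word length `|A|` of a positive braid `A`: the length of a positive word representing `A`.
By `wordLength_evalWord` all such words have the same length. -/
noncomputable def wordLength {n : ℕ} (A : Braid n) : ℕ :=
  sInf {l | ∃ w : PosWord n, evalWord w = A ∧ w.length = l}

/-- The decomposition `Q = A P`, where `A ∈ [0, 1]` and `P ≥ e`, is left-weighted: `|A|` is maximal
among all decompositions of `Q` of this kind. -/
def LeftWeighted {n : ℕ} (A P : Braid n) : Prop :=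
  InUnitInterval A ∧ Le 1 P ∧
    ∀ A' P' : Braid n, InUnitInterval A' → Le 1 P' → A' * P' = A * P →
      wordLength A' ≤ wordLength A

/-- `δ^u A_1 ⋯ A_k` (with `L = [A_1, …, A_k]`, possibly empty) is a left-canonical form of `W`. -/
def IsLeftCanonicalForm {n : ℕ} (W : Braid n) (u : ℤ) (L : List (Braid n)) : Prop :=
  W = delta n ^ u * L.prod ∧ (∀ A ∈ L, IsCanonicalFactor A) ∧ L.IsChain LeftWeighted

/-- The exponent sum. -/
def expSum (n : ℕ) : Braid n →* Multiplicative ℤ :=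
  PresentedGroup.toGroup (rels := artinRelators n) (f := fun _ => Multiplicative.ofAdd (1 : ℤ)) (by
    rintro r (⟨t, s, -, rfl⟩ | ⟨t, s, -, rfl⟩) <;> simp)

theorem expSum_band {n : ℕ} (p : BandIndex n) :
    expSum n (band n p.1.1 p.1.2) = Multiplicative.ofAdd 1 := by
  obtain ⟨⟨t, s⟩, h1, h2, h3⟩ := p
  have h : 1 ≤ s ∧ s < n := ⟨h1, lt_of_lt_of_le h2 h3⟩
  simp [band, sigma, h, expSum]

theorem expSum_evalWord {n : ℕ} (w : PosWord n) :
    expSum n (evalWord w) = Multiplicative.ofAdd (w.length : ℤ) := by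
  induction w with
  | nil => simp [evalWord]
  | cons p w ih =>
    have : evalWord (p :: w) = band n p.1.1 p.1.2 * evalWord w := by simp [evalWord]
    rw [this, map_mul, expSum_band, ih, ← ofAdd_add, List.length_cons]
    push_cast
    rw [add_comm]

/-- The length of a positive word depends only on the braid that it represents. -/
theorem wordLength_evalWord {n : ℕ} (w : PosWord n) : wordLength (evalWord w) = w.length := by
  have : {l | ∃ v : PosWord n, evalWord v = evalWord w ∧ v.length = l} = {w.length} := by
    ext l
    constructor
    · rintro ⟨v, hv, rfl⟩
      have h := expSum_evalWord v
      rw [hv, expSum_evalWord w] at h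
      exact_mod_cast (Multiplicative.ofAdd.injective h).symm
    · rintro rfl
      exact ⟨w, rfl, rfl⟩
  rw [wordLength, this, csInf_singleton]

end BandBraid

/-! Send `a_{ts}` to the transposition `(t s)`; then `δ` goes to the long cycle `c`. Reflection
length, the codimension of the space of invariants, is conjugation-invariant, and `x` is a prefix of
`y` when the lengths of `x` and `x⁻¹ y` add up to that of `y`. The prefixes of `c` are the
noncrossing permutations, and the argument is Garside theory for this interval.

Local structure (`atomicInterval`): two transpositions below `c` either have a join given by a
relation that also holds between band generators, or, when their chords cross, are linked by a third
transposition lying below every common upper bound in the interval. By induction on length this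
yields joins, hence meets (`exists_isJoin_aux`, `exists_meet`), and, as in Matsumoto's theorem, that
all reduced words of a prefix `x` of `c` represent one braid `simple x` (`prod_eq_of_reduced`).
These are exactly the braids between `e` and `δ` (`inUnitInterval_iff`), and left-weighted pairs of
nontrivial ones are the greedy pairs (`leftWeighted_iff`).

Existence: a simple factor multiplied on the left of a greedy sequence is pushed through it, each
entry giving up its largest piece that the factor before it can absorb (`ins`). The result is again
greedy (`greedy_mul_inf`), and factors `δ` collect at the front.

Uniqueness: insertion respects products inside the interval (`ins_ins`), and `c` acts by shifting
the exponent, so insertions are permutations of the set of normal forms. A map multiplicative on the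
interval extends to the braid group (`braidHom`), which therefore acts. Applied to the empty form,
`δ^u A₁ ⋯ A_k` gives back `(u, A₁, …, A_k)`. The values of inf and sup follow because conjugation by
`δ` preserves positivity and insertion never shortens a sequence. -/

namespace BandBraid

/-! ### Length functions and the prefix order -/

/-- A conjugation-invariant length function on a group. -/
structure LengthFn (G : Type*) [Group G] where
  len : G → ℕ
  len_one : len 1 = 0
  eq_one_of_len_eq_zero : ∀ x, len x = 0 → x = 1
  len_mul_le : ∀ x y, len (x * y) ≤ len x + len y
  len_conj : ∀ x y, len (y * x * y⁻¹) = len x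

namespace LengthFn

variable {G : Type*} [Group G] (D : LengthFn G)

/-- The prefix order of a length function. -/
def Pre (x y : G) : Prop := D.len x + D.len (x⁻¹ * y) = D.len y

variable {D} {x y z v c : G}

theorem len_le_add (x y : G) : D.len y ≤ D.len x + D.len (x⁻¹ * y) := by
  simpa using D.len_mul_le x (x⁻¹ * y)

theorem len_triangle (x y z : G) :
    D.len (x⁻¹ * z) ≤ D.len (x⁻¹ * y) + D.len (y⁻¹ * z) := by
  simpa [mul_assoc] using D.len_mul_le (x⁻¹ * y) (y⁻¹ * z)

theorem pre_refl (x : G) : D.Pre x x := by simp [Pre, D.len_one]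

theorem one_pre (x : G) : D.Pre 1 x := by simp [Pre, D.len_one]

theorem Pre.len_le (h : D.Pre x y) : D.len x ≤ D.len y := by
  unfold Pre at h; omega

theorem Pre.eq_of_len_le (h : D.Pre x y) (h' : D.len y ≤ D.len x) : x = y := by
  unfold Pre at h
  exact inv_mul_eq_one.mp (D.eq_one_of_len_eq_zero (x⁻¹ * y) (by omega))

theorem Pre.antisymm (h : D.Pre x y) (h' : D.Pre y x) : x = y := h.eq_of_len_le h'.len_le

theorem Pre.trans (h : D.Pre x y) (h' : D.Pre y z) : D.Pre x z := by
  unfold Pre at *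
  have := D.len_triangle x y z
  have := D.len_le_add x z
  omega

theorem Pre.eq_one (h : D.Pre x 1) : x = 1 := h.antisymm (one_pre x)

/-- Cancelling a common prefix. -/
theorem Pre.inv_mul (h : D.Pre x y) (h' : D.Pre y z) : D.Pre (x⁻¹ * y) (x⁻¹ * z) := by
  have h'' := h.trans h'
  unfold Pre at *
  have e : (x⁻¹ * y)⁻¹ * (x⁻¹ * z) = y⁻¹ * z := by group
  rw [e]
  omega

theorem pre_of_inv_mul (h : D.Pre x y) (h'' : D.Pre x z) (h' : D.Pre (x⁻¹ * y) (x⁻¹ * z)) :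
    D.Pre y z := by
  unfold Pre at *
  have e : (x⁻¹ * y)⁻¹ * (x⁻¹ * z) = y⁻¹ * z := by group
  rw [e] at h'
  omega

theorem Pre.pre_mul (h : D.Pre x z) (h' : D.Pre v (x⁻¹ * z)) : D.Pre x (x * v) := by
  unfold Pre at *
  have e : v⁻¹ * (x⁻¹ * z) = (x * v)⁻¹ * z := by group
  have := D.len_le_add (x * v) z
  have := D.len_mul_le x v
  rw [e] at h'
  rw [inv_mul_cancel_left]
  omega

theorem Pre.mul_pre (h : D.Pre x z) (h' : D.Pre v (x⁻¹ * z)) : D.Pre (x * v) z :=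
  pre_of_inv_mul (h.pre_mul h') h (by simpa using h')

theorem Pre.mul_pre_mul (h : D.Pre x (x * z)) (h' : D.Pre v z) : D.Pre (x * v) (x * z) :=
  h.mul_pre (by simpa using h')

/-- A suffix is also a prefix. -/
theorem Pre.inv_mul_pre (h : D.Pre x y) : D.Pre (x⁻¹ * y) y := by
  unfold Pre at *
  have e : (x⁻¹ * y)⁻¹ * y = (x⁻¹ * y)⁻¹ * x * ((x⁻¹ * y)⁻¹)⁻¹ := by group
  rw [e, D.len_conj]
  omega

theorem Pre.right_pre (h : D.Pre x (x * y)) : D.Pre y (x * y) := by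
  simpa using h.inv_mul_pre

theorem Pre.mul_inv_pre (h : D.Pre x y) : D.Pre (y * x⁻¹) y := by
  unfold Pre at *
  have e : x⁻¹ * y = x⁻¹ * (y * x⁻¹) * x⁻¹⁻¹ := by group
  rw [e, D.len_conj] at h
  have : (y * x⁻¹)⁻¹ * y = x := by group
  rw [this]
  omega

theorem Pre.conj (h : D.Pre x y) (g : G) : D.Pre (g * x * g⁻¹) (g * y * g⁻¹) := by
  unfold Pre at *
  have e : (g * x * g⁻¹)⁻¹ * (g * y * g⁻¹) = g * (x⁻¹ * y) * g⁻¹ := by group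
  rw [e, D.len_conj, D.len_conj, D.len_conj, h]

theorem pre_mul_iff : D.Pre x (x * y) ↔ D.len (x * y) = D.len x + D.len y := by
  simp [Pre, eq_comm]

/-! ### Joins and meets from relations between atoms -/

variable {H ι : Type*} [Group H] (D) (c) (τ : ι → G) (b : ι → H)

/-- Two atoms whose join is a product of two atoms in two ways, the same relation holding in
the group `H`. -/
def Adj (p q : ι) : Prop :=
  ∃ u v, τ p * τ u = τ q * τ v ∧ b p * b u = b q * b v ∧ D.Pre (τ p) (τ p * τ u) ∧
    D.Pre (τ q) (τ q * τ v) ∧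
    ∀ w, D.Pre w c → D.Pre (τ p) w → D.Pre (τ q) w → D.Pre (τ p * τ u) w

/-- The interval below `c` is generated by atoms, any two of which have a join given by
relations that hold in `H`. -/
structure AtomicInterval : Prop where
  len_atom : ∀ p, D.len (τ p) = 1
  atom_pre : ∀ p, D.Pre (τ p) c
  exists_atom : ∀ x, D.Pre x c → x ≠ 1 → ∃ p, D.Pre (τ p) x
  pair : ∀ p q, p ≠ q → D.Adj c τ b p q ∨ ∃ r, D.Adj c τ b p r ∧ D.Adj c τ b r q ∧
    ∀ w, D.Pre w c → D.Pre (τ p) w → D.Pre (τ q) w → D.Pre (τ r) w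

/-- `j` is the join of `x` and `y` below `c`. -/
def IsJoin (x y j : G) : Prop :=
  D.Pre x j ∧ D.Pre y j ∧ D.Pre j c ∧ ∀ w, D.Pre w c → D.Pre x w → D.Pre y w → D.Pre j w

variable {D c τ b}

/-- Let `m` be `z` times the join of the two atoms; it lies below every common upper bound of `x`
and `y`. Join `x` with `m` over `z * τ p`, join `y` with `m` over `z * τ q`, then join the results
over `z * τ p`. Each of these joins starts from a common prefix longer than `z`, so `ih` supplies
it. -/
theorem exists_isJoin_of_adj {p q : ι} (h : D.Adj c τ b p q) {z x y : G}
    (ih : ∀ r, D.Pre z (z * τ r) → ∀ x y, D.Pre (z * τ r) x → D.Pre (z * τ r) y → D.Pre x c →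
      D.Pre y c → ∃ j, D.IsJoin c x y j)
    (hzp : D.Pre z (z * τ p)) (hzq : D.Pre z (z * τ q))
    (hx : D.Pre (z * τ p) x) (hy : D.Pre (z * τ q) y) (hxc : D.Pre x c) (hyc : D.Pre y c) :
    ∃ j, D.IsJoin c x y j := by
  obtain ⟨u, v, huv, -, hp, hq, hj⟩ := h
  have key : ∀ w, D.Pre w c → D.Pre (z * τ p) w → D.Pre (z * τ q) w →
      D.Pre (τ p * τ u) (z⁻¹ * w) := fun w hw h1 h2 => by
    have hzw := hzp.trans h1
    refine hj _ (hzw.inv_mul_pre.trans hw) ?_ ?_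
    · simpa using hzp.inv_mul h1
    · simpa using hzq.inv_mul h2
  have hc := key c (pre_refl c) (hx.trans hxc) (hy.trans hyc)
  have hzc := hzp.trans (hx.trans hxc)
  have hmc : D.Pre (z * (τ p * τ u)) c := hzc.mul_pre hc
  have hzm := hzc.pre_mul hc
  have hpm : D.Pre (z * τ p) (z * (τ p * τ u)) := hzm.mul_pre_mul hp
  have hqm : D.Pre (z * τ q) (z * (τ p * τ u)) := hzm.mul_pre_mul (by rw [huv]; exact hq)
  obtain ⟨x', h1, h2, h3, h4⟩ := ih p hzp x _ hx hpm hxc hmc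
  obtain ⟨y', k1, k2, k3, k4⟩ := ih q hzq y _ hy hqm hyc hmc
  obtain ⟨j, l1, l2, l3, l4⟩ := ih p hzp x' y' (hx.trans h1) (hpm.trans k2) h3 k3
  refine ⟨j, h1.trans l1, k1.trans l2, l3, fun w hw hxw hyw => ?_⟩
  have hmw : D.Pre (z * (τ p * τ u)) w :=
    (hzp.trans (hx.trans hxw)).mul_pre (key w hw (hx.trans hxw) (hy.trans hyw))
  exact l4 w hw (h4 w hw hxw hmw) (k4 w hw hyw hmw)

namespace AtomicInterval

variable (A : D.AtomicInterval c τ b)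
include A

/-- The induction raises a common prefix `z` towards `c`. Linked atoms are treated by two adjacent
steps through `z * τ r`, which precedes every common upper bound. -/
theorem exists_isJoin_aux (k : ℕ) : ∀ z x y, D.len c ≤ D.len z + k → D.Pre z x → D.Pre z y →
    D.Pre x c → D.Pre y c → ∃ j, D.IsJoin c x y j := by
  induction k with
  | zero =>
    intro z x y hk hx hy hxc hyc
    have h : z = y := hy.eq_of_len_le (hyc.len_le.trans hk)
    exact ⟨x, pre_refl x, h ▸ hx, hxc, fun w _ h _ => h⟩
  | succ k ih =>
    intro z x y hk hx hy hxc hyc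
    by_cases hzx : z⁻¹ * x = 1
    · have h : z = x := inv_mul_eq_one.mp hzx
      exact ⟨y, h ▸ hy, pre_refl y, hyc, fun w _ _ h => h⟩
    by_cases hzy : z⁻¹ * y = 1
    · have h : z = y := inv_mul_eq_one.mp hzy
      exact ⟨x, pre_refl x, h ▸ hx, hxc, fun w _ h _ => h⟩
    have ih' : ∀ r, D.Pre z (z * τ r) → ∀ x y, D.Pre (z * τ r) x → D.Pre (z * τ r) y →
        D.Pre x c → D.Pre y c → ∃ j, D.IsJoin c x y j := fun r hr x y =>
      ih (z * τ r) x y (by have := pre_mul_iff.mp hr; have := A.len_atom r; omega)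
    obtain ⟨p, hp⟩ := A.exists_atom _ (hx.inv_mul_pre.trans hxc) hzx
    obtain ⟨q, hq⟩ := A.exists_atom _ (hy.inv_mul_pre.trans hyc) hzy
    have hzp := hx.pre_mul hp
    have hzq := hy.pre_mul hq
    have hpx := hx.mul_pre hp
    have hqy := hy.mul_pre hq
    by_cases hpq : p = q
    · subst hpq
      exact ih' p hzp x y hpx hqy hxc hyc
    obtain h | ⟨r, h1, h2, hr⟩ := A.pair p q hpq
    · exact exists_isJoin_of_adj h ih' hzp hzq hpx hqy hxc hyc
    have key : ∀ w, D.Pre w c → D.Pre x w → D.Pre y w → D.Pre (τ r) (z⁻¹ * w) :=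
      fun w hw hxw hyw => hr _ ((hx.trans hxw).inv_mul_pre.trans hw)
        (hp.trans (hx.inv_mul hxw)) (hq.trans (hy.inv_mul hyw))
    have hzc := hx.trans hxc
    have hrc := key c (pre_refl c) hxc hyc
    have hzr := hzc.pre_mul hrc
    have hzrc := hzc.mul_pre hrc
    obtain ⟨x', a1, a2, a3, a4⟩ := exists_isJoin_of_adj h1 ih' hzp hzr hpx (pre_refl _) hxc hzrc
    obtain ⟨y', b1, b2, b3, b4⟩ := exists_isJoin_of_adj h2 ih' hzr hzq (pre_refl _) hqy hzrc hyc
    obtain ⟨j, l1, l2, l3, l4⟩ := ih' r hzr x' y' a2 b1 a3 b3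
    refine ⟨j, a1.trans l1, b2.trans l2, l3, fun w hw hxw hyw => ?_⟩
    have hrw := (hx.trans hxw).mul_pre (key w hw hxw hyw)
    exact l4 w hw (a4 w hw hxw hrw) (b4 w hw hrw hyw)

theorem exists_isJoin (hx : D.Pre x c) (hy : D.Pre y c) : ∃ j, D.IsJoin c x y j :=
  A.exists_isJoin_aux (D.len c) 1 x y (by omega) (one_pre x) (one_pre y) hx hy

/-- A longest common prefix works: its join with any other common prefix is again a common prefix,
hence not longer. -/
theorem exists_meet (hx : D.Pre x c) (hy : D.Pre y c) :
    ∃ z, D.Pre z x ∧ D.Pre z y ∧ ∀ w, D.Pre w x → D.Pre w y → D.Pre w z := by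
  classical
  let Q : ℕ → Prop := fun k => ∃ z, D.Pre z x ∧ D.Pre z y ∧ D.len z = k
  have h0 : Q 0 := ⟨1, one_pre x, one_pre y, D.len_one⟩
  obtain ⟨z, h1, h2, h3⟩ : Q (Nat.findGreatest Q (D.len x)) :=
    Nat.findGreatest_spec (Nat.zero_le _) h0
  refine ⟨z, h1, h2, fun w hwx hwy => ?_⟩
  obtain ⟨j, a1, a2, a3, a4⟩ := A.exists_isJoin (h1.trans hx) (hwx.trans hx)
  have hjx := a4 x hx h1 hwx
  have hjy := a4 y hy h2 hwy
  have : D.len j ≤ Nat.findGreatest Q (D.len x) :=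
    Nat.le_findGreatest hjx.len_le ⟨j, hjx, hjy, rfl⟩
  rw [a1.eq_of_len_le (by omega)]
  exact a2

/-! ### Reduced words and their lift to a second group -/

theorem len_prod_le (w : List ι) : D.len (w.map τ).prod ≤ w.length := by
  induction w with
  | nil => simp [D.len_one]
  | cons p w ih =>
    have := D.len_mul_le (τ p) (w.map τ).prod
    have := A.len_atom p
    simp only [List.map_cons, List.prod_cons, List.length_cons]
    omega

theorem exists_word (k : ℕ) : ∀ x, D.len x = k → D.Pre x c →
    ∃ w : List ι, (w.map τ).prod = x ∧ w.length = k := by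
  induction k with
  | zero => exact fun x hx _ => ⟨[], by simp [D.eq_one_of_len_eq_zero x hx], rfl⟩
  | succ k ih =>
    intro x hx hxc
    obtain ⟨p, hp⟩ := A.exists_atom x hxc (by rintro rfl; rw [D.len_one] at hx; omega)
    have hp' := hp
    unfold Pre at hp'
    have := A.len_atom p
    obtain ⟨w, hw, hwl⟩ := ih ((τ p)⁻¹ * x) (by omega) (hp.inv_mul_pre.trans hxc)
    exact ⟨p :: w, by simp [hw], by simp [hwl]⟩

theorem pre_of_reduced_cons {p : ι} {w : List ι}
    (h : D.len ((p :: w).map τ).prod = (p :: w).length) :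
    D.len (w.map τ).prod = w.length ∧ D.Pre (τ p) (τ p * (w.map τ).prod) := by
  have h1 := D.len_mul_le (τ p) (w.map τ).prod
  have h2 := A.len_prod_le w
  have h3 := A.len_atom p
  simp only [List.map_cons, List.prod_cons, List.length_cons] at h
  exact ⟨by omega, pre_mul_iff.mpr (by omega)⟩

/-- Since `x` lies above the join `τ p * τ u = τ q * τ v`, complete it by a reduced word `w₀`. By
induction `w` may be replaced by `u :: w₀` and `w'` by `v :: w₀`, and then the relation in `H`
applies. -/
theorem prod_eq_of_adj {k : ℕ}
    (ih : ∀ w w' : List ι, w.length = k → w'.length = k → (w.map τ).prod = (w'.map τ).prod →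
      D.len (w.map τ).prod = k → D.Pre (w.map τ).prod c → (w.map b).prod = (w'.map b).prod)
    {p q : ι} (h : D.Adj c τ b p q) {x : G} (hxc : D.Pre x c)
    (hp : D.Pre (τ p) x) (hq : D.Pre (τ q) x) {w w' : List ι}
    (hw : (w.map τ).prod = (τ p)⁻¹ * x) (hw' : (w'.map τ).prod = (τ q)⁻¹ * x)
    (hwl : w.length = k) (hwl' : w'.length = k)
    (hx : D.len x = k + 1) : b p * (w.map b).prod = b q * (w'.map b).prod := by
  obtain ⟨u, v, huv, hb, h1, h2, h3⟩ := h
  have hm := h3 x hxc hp hq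
  have len_rest : ∀ r, D.Pre (τ r) x → D.len ((τ r)⁻¹ * x) = k := fun r hr => by
    have := A.len_atom r
    unfold Pre at hr
    omega
  obtain ⟨w₀, hw₀, hw₀l⟩ := A.exists_word _ _ rfl (hm.inv_mul_pre.trans hxc)
  have hl := pre_mul_iff.mp h1
  have hl' := hm
  unfold Pre at hl'
  have := A.len_atom p
  have := A.len_atom u
  have e1 := ih w (u :: w₀) hwl (by simp only [List.length_cons]; omega)
    (by rw [List.map_cons, List.prod_cons, hw, hw₀]; group) (by rw [hw]; exact len_rest p hp)
    (by rw [hw]; exact hp.inv_mul_pre.trans hxc)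
  have e2 := ih w' (v :: w₀) hwl' (by simp only [List.length_cons]; omega)
    (by rw [List.map_cons, List.prod_cons, hw', hw₀, huv]; group)
    (by rw [hw']; exact len_rest q hq)
    (by rw [hw']; exact hq.inv_mul_pre.trans hxc)
  rw [e1, e2, List.map_cons, List.map_cons, List.prod_cons, List.prod_cons, ← mul_assoc,
    ← mul_assoc, hb]

/-- All reduced words of an element of the interval represent the same element of `H`. -/
theorem prod_eq_of_reduced (k : ℕ) : ∀ w w' : List ι, w.length = k → w'.length = k →
    (w.map τ).prod = (w'.map τ).prod → D.len (w.map τ).prod = k → D.Pre (w.map τ).prod c →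
    (w.map b).prod = (w'.map b).prod := by
  induction k with
  | zero =>
    intro w w' h h' _ _ _
    rw [List.length_eq_zero_iff.mp h, List.length_eq_zero_iff.mp h']
  | succ k ih =>
    rintro (_ | ⟨p, w⟩) (_ | ⟨q, w'⟩) h h' he hl hc
    · simp at h
    · simp at h
    · simp at h'
    have hp := A.pre_of_reduced_cons (hl.trans h.symm)
    have hq := A.pre_of_reduced_cons ((he ▸ hl).trans h'.symm)
    simp only [List.map_cons, List.prod_cons, List.length_cons, Nat.add_right_cancel_iff]
      at h h' he hl hc ⊢
    rw [← he] at hq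
    by_cases hpq : p = q
    · subst hpq
      rw [ih w w' h h' (mul_left_cancel he) (hp.1.trans h) (hp.2.right_pre.trans hc)]
    have e1 : (w.map τ).prod = (τ p)⁻¹ * (τ p * (w.map τ).prod) := by group
    have e2 : (w'.map τ).prod = (τ q)⁻¹ * (τ p * (w.map τ).prod) := by rw [he]; group
    obtain hA | ⟨r, h1, h2, hr⟩ := A.pair p q hpq
    · exact A.prod_eq_of_adj ih hA hc hp.2 hq.2 e1 e2 h h' hl
    · have hr' := hr _ hc hp.2 hq.2
      have hlr := hr'
      unfold Pre at hlr
      have := A.len_atom r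
      obtain ⟨w₀, hw₀, hw₀l⟩ := A.exists_word _ _ rfl (hr'.inv_mul_pre.trans hc)
      exact (A.prod_eq_of_adj ih h1 hc hp.2 hr' e1 hw₀ h (by omega) hl).trans
        (A.prod_eq_of_adj ih h2 hc hr' hq.2 hw₀ e2 (by omega) h' hl)

end AtomicInterval

variable (D τ b) in
open Classical in
/-- The lift to `H` of an element of the interval: the value in `H` of any reduced word. -/
noncomputable def lift (x : G) : H :=
  if h : ∃ w : List ι, (w.map τ).prod = x ∧ w.length = D.len x then (h.choose.map b).prod else 1

namespace AtomicInterval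

variable (A : D.AtomicInterval c τ b)
include A

theorem lift_prod {w : List ι} (hw : D.len (w.map τ).prod = w.length)
    (hc : D.Pre (w.map τ).prod c) : D.lift τ b (w.map τ).prod = (w.map b).prod := by
  have h : ∃ v : List ι, (v.map τ).prod = (w.map τ).prod ∧ v.length = D.len (w.map τ).prod :=
    ⟨w, rfl, hw.symm⟩
  rw [lift, dif_pos h]
  exact A.prod_eq_of_reduced _ _ _ h.choose_spec.2 hw.symm h.choose_spec.1
    (by rw [h.choose_spec.1]) (by rw [h.choose_spec.1]; exact hc)

theorem exists_word_lift (hx : D.Pre x c) :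
    ∃ w : List ι, (w.map τ).prod = x ∧ w.length = D.len x ∧ (w.map b).prod = D.lift τ b x := by
  obtain ⟨w, rfl, hl⟩ := A.exists_word _ x rfl hx
  exact ⟨w, rfl, hl, (A.lift_prod hl.symm hx).symm⟩

theorem lift_mul (h : D.Pre x (x * y)) (hc : D.Pre (x * y) c) :
    D.lift τ b (x * y) = D.lift τ b x * D.lift τ b y := by
  obtain ⟨w, hw, hwl, hwb⟩ := A.exists_word_lift (h.trans hc)
  obtain ⟨v, hv, hvl, hvb⟩ := A.exists_word_lift (h.right_pre.trans hc)
  have e : ((w ++ v).map τ).prod = x * y := by simp [hw, hv]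
  rw [← e, A.lift_prod (by rw [e, pre_mul_iff.mp h, List.length_append, hwl, hvl]) (by rwa [e]),
    ← hwb, ← hvb]
  simp

theorem lift_atom (p : ι) : D.lift τ b (τ p) = b p := by
  have := A.lift_prod (w := [p]) (by simp [A.len_atom]) (by simpa using A.atom_pre p)
  simpa using this

theorem lift_one : D.lift τ b 1 = 1 := by
  have := A.lift_prod (w := []) (by simp [D.len_one]) (by simpa using one_pre c)
  simpa using this

end AtomicInterval
end LengthFn
end BandBraid

/-! ### Greedy normal sequences and insertion of a factor -/

namespace BandBraid
namespace LengthFn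

variable {G : Type*} [Group G] {D : LengthFn G} {c : G}

variable (D c) in
/-- The interval below `c` is a meet-semilattice, with a chosen meet operation. -/
structure MeetInterval where
  inf : G → G → G
  inf_left : ∀ {x y}, D.Pre x c → D.Pre y c → D.Pre (inf x y) x
  inf_right : ∀ {x y}, D.Pre x c → D.Pre y c → D.Pre (inf x y) y
  pre_inf : ∀ {x y w}, D.Pre x c → D.Pre y c → D.Pre w x → D.Pre w y → D.Pre w (inf x y)
  ne_one : c ≠ 1

variable (D c) in
/-- No nontrivial prefix of `y` can be absorbed by `x` within the interval below `c`. -/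
def Greedy (x y : G) : Prop := ∀ t, D.Pre t (x⁻¹ * c) → D.Pre t y → t = 1

variable (D c) in
/-- Normal sequences of nontrivial elements of the interval below `c`. -/
def Normal (L : List G) : Prop := (∀ x ∈ L, D.Pre x c ∧ x ≠ 1) ∧ L.IsChain (D.Greedy c)

theorem normal_nil : D.Normal c [] := ⟨by simp, List.IsChain.nil⟩

theorem normal_cons {x : G} {L : List G} :
    D.Normal c (x :: L) ↔
      (D.Pre x c ∧ x ≠ 1) ∧ (∀ y ∈ L.head?, D.Greedy c x y) ∧ D.Normal c L := by
  simp only [Normal, List.forall_mem_cons, List.isChain_cons]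
  tauto

theorem normal_singleton {x : G} (hx : D.Pre x c) (h1 : x ≠ 1) : D.Normal c [x] :=
  normal_cons.mpr ⟨⟨hx, h1⟩, by simp, normal_nil⟩

theorem greedy_self_left (x : G) : D.Greedy c c x := fun t ht _ => by
  rw [inv_mul_cancel] at ht
  exact ht.eq_one

theorem Normal.cons_top {L : List G} (I : D.MeetInterval c) (h : D.Normal c L) :
    D.Normal c (c :: L) :=
  normal_cons.mpr ⟨⟨pre_refl c, I.ne_one⟩, fun y _ => greedy_self_left y, h⟩

/-- The interval below `c` is stable under conjugation by powers of `c`. -/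
theorem Pre.conj_pow {x : G} (h : D.Pre x c) (u : ℤ) : D.Pre (c ^ (-u) * x * c ^ u) c := by
  have := h.conj (c ^ (-u))
  rwa [← zpow_neg, neg_neg, zpow_neg, ← zpow_neg, mul_assoc _ c, ← zpow_one_add, ← zpow_add,
    show -u + (1 + u) = 1 by ring, zpow_one] at this

namespace MeetInterval

variable (I : D.MeetInterval c)

open Classical in
/-- Left multiplication of a normal sequence by an element of the interval. -/
noncomputable def ins : G → List G → List G
  | y, [] => if y = 1 then [] else [y]
  | y, x :: L => (y * I.inf (y⁻¹ * c) x) :: ins ((I.inf (y⁻¹ * c) x)⁻¹ * x) L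

theorem inf_eq {x y z : G} (hx : D.Pre x c) (hy : D.Pre y c) (h1 : D.Pre z x) (h2 : D.Pre z y)
    (h : ∀ w, D.Pre w x → D.Pre w y → D.Pre w z) : I.inf x y = z :=
  (h _ (I.inf_left hx hy) (I.inf_right hx hy)).antisymm (I.pre_inf hx hy h1 h2)

theorem length_le_length_ins (y : G) (L : List G) : L.length ≤ (I.ins y L).length := by
  induction L generalizing y with
  | nil => simp
  | cons x L ih => simpa [ins] using ih _

/-- The domino rule: after `x` gives up its piece `z` to `y`, the remainder may take a piece `v` of
the next entry without spoiling greediness on its left, because `x` itself could absorb nothing from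
`v`. -/
theorem greedy_mul_inf {x y v : G} (hx : D.Pre x c) (hy : D.Pre y c)
    (hv : D.Pre ((I.inf (y⁻¹ * c) x)⁻¹ * x) ((I.inf (y⁻¹ * c) x)⁻¹ * x * v))
    (hvc : D.Pre ((I.inf (y⁻¹ * c) x)⁻¹ * x * v) c) (h : D.Greedy c x v) :
    D.Greedy c (y * I.inf (y⁻¹ * c) x) ((I.inf (y⁻¹ * c) x)⁻¹ * x * v) := by
  have hyc := hy.inv_mul_pre
  have hzy := I.inf_left hyc hx
  have hzx := I.inf_right hyc hx
  have hzz : ∀ w, D.Pre w (y⁻¹ * c) → D.Pre w x → D.Pre w (I.inf (y⁻¹ * c) x) :=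
    fun w => I.pre_inf hyc hx
  generalize I.inf (y⁻¹ * c) x = z at *
  intro t ht1 ht2
  rw [show (y * z)⁻¹ * c = z⁻¹ * (y⁻¹ * c) by group] at ht1
  have hzt := hzy.mul_pre ht1
  have hzzt := hzy.pre_mul ht1
  have htc : D.Pre t (z⁻¹ * c) := by simpa using hzzt.inv_mul (hzt.trans hyc)
  have hzc : D.Pre (z⁻¹ * c) c := (hzx.trans hx).inv_mul_pre
  have hxz : D.Pre (z⁻¹ * x) (z⁻¹ * c) := hzx.inv_mul hx
  -- The meet of `z⁻¹ * x * v` with `z⁻¹ * c` lies above `z⁻¹ * x`; the quotient is a prefix of `v`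
  -- absorbable by `x`, hence trivial. So `t` is a prefix of `z⁻¹ * x`, and `z * t` a prefix of `x`,
  -- contradicting maximality of `z` unless `t = 1`.
  have a1 := I.inf_left hvc hzc
  have a2 := I.inf_right hvc hzc
  have a3 := I.pre_inf hvc hzc ht2 htc
  have a4 := I.pre_inf hvc hzc hv hxz
  generalize I.inf (z⁻¹ * x * v) (z⁻¹ * c) = m at *
  have b1 : D.Pre ((z⁻¹ * x)⁻¹ * m) v := by
    have := a4.inv_mul a1
    rwa [inv_mul_cancel_left] at this
  have b2 : D.Pre ((z⁻¹ * x)⁻¹ * m) (x⁻¹ * c) := by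
    have := a4.inv_mul a2
    rwa [show (z⁻¹ * x)⁻¹ * (z⁻¹ * c) = x⁻¹ * c by group] at this
  rw [← inv_mul_eq_one.mp (h _ b2 b1)] at a3
  have := hzzt.antisymm (hzz _ hzt (hzx.mul_pre a3))
  simpa using this

theorem normal_ins {y : G} (hy : D.Pre y c) {L : List G} (hL : D.Normal c L) :
    D.Normal c (I.ins y L) := by
  induction L generalizing y with
  | nil =>
    by_cases h : y = 1
    · simp [ins, h, normal_nil]
    · simp only [ins, h, if_false]
      exact normal_singleton hy h
  | cons x L ih =>
    obtain ⟨⟨hx, hx1⟩, hg, hL⟩ := normal_cons.mp hL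
    have hyc := hy.inv_mul_pre
    have hzy := I.inf_left hyc hx
    have hzx := I.inf_right hyc hx
    have hx' := hzx.inv_mul_pre.trans hx
    refine normal_cons.mpr ⟨⟨hy.mul_pre hzy, fun h => hx1 ?_⟩, ?_, ih hx' hL⟩
    -- A trivial head forces `y = 1`; the meet is then all of `x`, so `x = 1`.
    · have h1 := pre_mul_iff.mp (hy.pre_mul hzy)
      rw [h, D.len_one] at h1
      have hy1 := D.eq_one_of_len_eq_zero y (by omega)
      subst hy1
      have := I.pre_inf hyc hx (by simpa using hx) (pre_refl x)
      rw [one_mul] at h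
      rw [h] at this
      exact this.eq_one
    · cases L with
      | nil =>
        have := I.greedy_mul_inf hx hy (v := 1) (by simpa using pre_refl _) (by simpa using hx')
          (fun t _ ht => ht.eq_one)
        rw [mul_one] at this
        intro w hw
        by_cases h : (I.inf (y⁻¹ * c) x)⁻¹ * x = 1
        · simp [ins, h] at hw
        · simp only [ins, h, if_false, List.head?_cons, Option.mem_some_iff] at hw
          exact hw ▸ this
      | cons x₂ L =>
        have hx₂ := (normal_cons.mp hL).1.1
        have hxc' := hx'.inv_mul_pre
        have l := I.inf_left hxc' hx₂
        -- Here `v` is the piece that the next insertion takes from `x₂`.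
        have := I.greedy_mul_inf hx hy (hx'.pre_mul l) (hx'.mul_pre l)
          (fun t ht1 ht2 => hg x₂ (by simp) t ht1 (ht2.trans (I.inf_right hxc' hx₂)))
        intro w hw
        simp only [ins, List.head?_cons, Option.mem_some_iff] at hw
        exact hw ▸ this

theorem ins_eq_cons {x : G} {L : List G} (h : D.Normal c (x :: L)) : I.ins x L = x :: L := by
  induction L generalizing x with
  | nil => simp [ins, (normal_cons.mp h).1.2]
  | cons y L ih =>
    obtain ⟨⟨hx, hx1⟩, hg, hL⟩ := normal_cons.mp h
    have hy := (normal_cons.mp hL).1.1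
    have hz : I.inf (x⁻¹ * c) y = 1 :=
      hg y (by simp) _ (I.inf_left hx.inv_mul_pre hy) (I.inf_right hx.inv_mul_pre hy)
    simp [ins, hz, ih hL]

/-- The heads agree by `key`, and the leftovers passed to the tail have the same product, so the
induction continues. -/
theorem ins_ins {x y : G} (hxy : D.Pre x (x * y)) (hc : D.Pre (x * y) c) {L : List G}
    (hL : D.Normal c L) : I.ins x (I.ins y L) = I.ins (x * y) L := by
  have hx := hxy.trans hc
  have hy := hxy.right_pre.trans hc
  have hyx : D.Pre y (x⁻¹ * c) := by simpa using hxy.inv_mul hc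
  induction L generalizing x y with
  | nil =>
    by_cases h : y = 1
    · subst h
      rw [mul_one, ins, if_pos rfl]
    · have hz : I.inf (x⁻¹ * c) y = y :=
        I.inf_eq hx.inv_mul_pre hy hyx (pre_refl y) fun w _ h => h
      have h' : x * y ≠ 1 := fun h' => h (by rw [h'] at hxy hc; simpa [hxy.eq_one] using h')
      simp [ins, h, hz, h']
  | cons p L ih =>
    obtain ⟨⟨hp, -⟩, -, hL⟩ := normal_cons.mp hL
    have hyz := I.inf_left hy.inv_mul_pre hp
    have hzp := I.inf_right hy.inv_mul_pre hp
    have hmul := hy.mul_pre hyz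
    have hw : (x * y)⁻¹ * c = y⁻¹ * (x⁻¹ * c) := by group
    have h3l := I.inf_left hc.inv_mul_pre hp
    have h3r := I.inf_right hc.inv_mul_pre hp
    have h3y : D.Pre (I.inf ((x * y)⁻¹ * c) p) (y⁻¹ * c) := by
      refine h3l.trans ?_
      rw [hw]
      exact hyx.inv_mul hx.inv_mul_pre
    have h3z := I.pre_inf hy.inv_mul_pre hp h3y h3r
    -- What `x` absorbs from the enlarged head is `y` followed by what `x * y` absorbs from `p`.
    have key : I.inf (x⁻¹ * c) (y * I.inf (y⁻¹ * c) p) = y * I.inf ((x * y)⁻¹ * c) p := by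
      refine I.inf_eq hx.inv_mul_pre hmul (hyx.mul_pre (hw ▸ h3l))
        ((hy.pre_mul hyz).mul_pre_mul h3z) fun w h1 h2 => ?_
      have hq1 := I.inf_left hx.inv_mul_pre hmul
      have hq2 := I.inf_right hx.inv_mul_pre hmul
      have hq3 := I.pre_inf hx.inv_mul_pre hmul h1 h2
      have hq4 := I.pre_inf hx.inv_mul_pre hmul hyx (hy.pre_mul hyz)
      refine hq3.trans ?_
      generalize I.inf (x⁻¹ * c) (y * I.inf (y⁻¹ * c) p) = q at *
      have r1 : D.Pre (y⁻¹ * q) ((x * y)⁻¹ * c) := hw ▸ hq4.inv_mul hq1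
      have r2 : D.Pre (y⁻¹ * q) p := by
        have := hq4.inv_mul hq2
        rw [inv_mul_cancel_left] at this
        exact this.trans hzp
      have r3 := I.pre_inf hc.inv_mul_pre hp r1 r2
      have := (hy.pre_mul h3y).mul_pre_mul r3
      rwa [mul_inv_cancel_left] at this
    generalize hz : I.inf (y⁻¹ * c) p = z at *
    generalize hz3 : I.inf ((x * y)⁻¹ * c) p = z3 at *
    have e : z3⁻¹ * p = (z3⁻¹ * z) * (z⁻¹ * p) := by group
    have hpre := h3z.inv_mul hzp
    have hpc := h3r.inv_mul_pre.trans hp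
    rw [e] at hpre hpc
    simp only [ins, hz, hz3, key]
    rw [show (y * z3)⁻¹ * (y * z) = z3⁻¹ * z by group, e, mul_assoc x y]
    congr 1
    exact ih hpre hpc hL (hpre.trans hpc) (hpre.right_pre.trans hpc)
      (by simpa using hpre.inv_mul hpc)

theorem ins_top {L : List G} (h : D.Normal c L) : I.ins c L = c :: L :=
  I.ins_eq_cons (h.cons_top I)

/-- `y` is completed to `c` by `y⁻¹ * c`, and what is left of the old `c` is the conjugate `c⁻¹ * y
* c`. -/
theorem ins_cons_top {y : G} (hy : D.Pre y c) (L : List G) :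
    I.ins y (c :: L) = c :: I.ins (c⁻¹ * y * c) L := by
  have hz : I.inf (y⁻¹ * c) c = y⁻¹ * c :=
    I.inf_eq hy.inv_mul_pre (pre_refl c) (pre_refl _) hy.inv_mul_pre fun w h _ => h
  rw [ins, hz, mul_inv_cancel_left]
  congr 2
  group

theorem prod_map_ins {H : Type*} [Group H] {s : G → H}
    (hs : ∀ x y, D.Pre x (x * y) → D.Pre (x * y) c → s (x * y) = s x * s y) (h1 : s 1 = 1)
    {y : G} (hy : D.Pre y c) {L : List G} (hL : D.Normal c L) :
    ((I.ins y L).map s).prod = s y * (L.map s).prod := by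
  induction L generalizing y with
  | nil => by_cases h : y = 1 <;> simp [ins, h, h1]
  | cons x L ih =>
    obtain ⟨⟨hx, -⟩, -, hL⟩ := normal_cons.mp hL
    have hzy := I.inf_left hy.inv_mul_pre hx
    have hzx := I.inf_right hy.inv_mul_pre hx
    have e : s x = s (I.inf (y⁻¹ * c) x) * s ((I.inf (y⁻¹ * c) x)⁻¹ * x) := by
      rw [← hs _ _ (by simpa using hzx) (by simpa using hx), mul_inv_cancel_left]
    simp only [ins, List.map_cons, List.prod_cons]
    rw [hs _ _ (hy.pre_mul hzy) (hy.mul_pre hzy), ih (hzx.inv_mul_pre.trans hx) hL, e]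
    simp only [mul_assoc]

theorem exists_head_ins (y : G) {L : List G} {h : G} (hL : D.Normal c L) (hy : D.Pre y c)
    (hh : h ∈ (I.ins y L).head?) : D.Pre y h := by
  cases L with
  | nil =>
    by_cases h1 : y = 1
    · simp [ins, h1] at hh
    · simp only [ins, h1, if_false, List.head?_cons, Option.mem_some_iff] at hh
      exact hh ▸ pre_refl y
  | cons x L =>
    have hx := (normal_cons.mp hL).1.1
    simp only [ins, List.head?_cons, Option.mem_some_iff] at hh
    exact hh ▸ hy.pre_mul (I.inf_left hy.inv_mul_pre hx)

/-! ### Normal forms and the action on them -/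

open Classical in
/-- Absorb the leading copies of `c` of a sequence into the exponent. -/
noncomputable def strip {α : Type*} (c : α) : ℤ → List α → ℤ × List α
  | u, [] => (u, [])
  | u, x :: L => if x = c then strip c (u + 1) L else (u, x :: L)

theorem strip_cons_top {α : Type*} (c : α) (u : ℤ) (L : List α) :
    strip c u (c :: L) = strip c (u + 1) L := by
  simp [strip]

theorem strip_eq_self {α : Type*} {c : α} {u : ℤ} {L : List α} (h : c ∉ L) :
    strip c u L = (u, L) := by
  cases L with
  | nil => rfl
  | cons x L =>
    have : x ≠ c := fun e => h (by simp [e])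
    simp [strip, this]

/-- An entry `x` directly before a `c` can absorb its whole complement `x⁻¹ * c`, so greediness
gives `x = c`. All copies of `c` therefore stand at the front. -/
theorem top_not_mem_of_normal_cons {x : G} {L : List G} (h : D.Normal c (x :: L)) (hx : x ≠ c) :
    c ∉ x :: L := by
  induction L generalizing x with
  | nil => simpa using hx.symm
  | cons y L ih =>
    obtain ⟨⟨hxc, hx1⟩, hg, hL⟩ := normal_cons.mp h
    have hy : y ≠ c := by
      rintro rfl
      exact hx (inv_mul_eq_one.mp (hg y (by simp) _ (pre_refl _) hxc.inv_mul_pre))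
    have := ih hL hy
    simp only [List.mem_cons, not_or] at this ⊢
    exact ⟨hx.symm, this⟩

theorem exists_strip {L : List G} (hL : D.Normal c L) (u : ℤ) :
    ∃ (a : ℕ) (L' : List G), L = List.replicate a c ++ L' ∧ D.Normal c L' ∧ c ∉ L' ∧
      strip c u L = (u + a, L') := by
  induction L generalizing u with
  | nil => exact ⟨0, [], rfl, normal_nil, by simp, by simp [strip]⟩
  | cons x L ih =>
    by_cases h : x = c
    · subst h
      obtain ⟨a, L', rfl, h2, h3, h4⟩ := ih (normal_cons.mp hL).2.2 (u + 1)
      refine ⟨a + 1, L', by simp [List.replicate_succ], h2, h3, ?_⟩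
      rw [strip_cons_top, h4]
      push_cast
      congr 1
      ring
    · have h' := top_not_mem_of_normal_cons hL h
      exact ⟨0, x :: L, rfl, hL, h', by simp [strip_eq_self h']⟩

variable (D c) in
/-- The set of normal forms `c ^ u * L`. -/
abbrev NF : Type _ := {p : ℤ × List G // D.Normal c p.2 ∧ c ∉ p.2}

/-- The normal form of `c ^ u * L`, for a normal sequence `L`. -/
noncomputable def toNF (u : ℤ) (L : List G) (hL : D.Normal c L) : NF D c :=
  ⟨strip c u L, by
    obtain ⟨a, L', -, h1, h2, h3⟩ := exists_strip hL u
    rw [h3]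
    exact ⟨h1, h2⟩⟩

/-- The action of an element of the interval on normal forms. -/
noncomputable def act (y : G) (hy : D.Pre y c) (p : NF D c) : NF D c :=
  toNF p.1.1 (I.ins (c ^ (-p.1.1) * y * c ^ p.1.1) p.1.2) (I.normal_ins (hy.conj_pow _) p.2.1)

theorem toNF_congr {u v : ℤ} {L M : List G} {hL : D.Normal c L} {hM : D.Normal c M} (huv : u = v)
    (hLM : L = M) : toNF u L hL = toNF v M hM := by
  subst huv hLM
  rfl

/-- Moving `y` past `c ^ u` conjugates it, and `ins_cons_top` conjugates in the same way for each
leading `c`. Hence stripping may be done before or after the insertion. -/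
theorem act_toNF {y : G} (hy : D.Pre y c) {u : ℤ} {L : List G} (hL : D.Normal c L) :
    I.act y hy (toNF u L hL) =
      toNF u (I.ins (c ^ (-u) * y * c ^ u) L) (I.normal_ins (hy.conj_pow u) hL) := by
  induction L generalizing u with
  | nil => rfl
  | cons x L ih =>
    by_cases h : x = c
    · subst h
      have hL' := (normal_cons.mp hL).2.2
      have e1 : toNF u (x :: L) hL = toNF (u + 1) L hL' := Subtype.ext (strip_cons_top x u L)
      have e2 : x⁻¹ * (x ^ (-u) * y * x ^ u) * x = x ^ (-(u + 1)) * y * x ^ (u + 1) := by group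
      rw [e1, ih]
      refine Subtype.ext ?_
      change strip _ _ _ = strip _ _ _
      rw [I.ins_cons_top (hy.conj_pow u), strip_cons_top, e2]
    · have h' := top_not_mem_of_normal_cons hL h
      have e1 : toNF u (x :: L) hL = ⟨(u, x :: L), hL, h'⟩ := Subtype.ext (strip_eq_self h')
      rw [e1]
      rfl

theorem act_act {x y : G} (hxy : D.Pre x (x * y)) (hc : D.Pre (x * y) c) (p : NF D c) :
    I.act x (hxy.trans hc) (I.act y (hxy.right_pre.trans hc) p) = I.act (x * y) hc p := by
  have h1 := I.act_toNF (hxy.trans hc) (u := p.1.1)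
    (I.normal_ins ((hxy.right_pre.trans hc).conj_pow p.1.1) p.2.1)
  refine h1.trans ?_
  have e : ∀ u : ℤ, c ^ (-u) * (x * y) * c ^ u = (c ^ (-u) * x * c ^ u) * (c ^ (-u) * y * c ^ u) :=
    fun u => by group
  refine toNF_congr rfl ?_
  rw [I.ins_ins _ _ p.2.1, e]
  · have := hxy.conj (c ^ (-p.1.1))
    rw [← zpow_neg, neg_neg] at this
    rwa [← e]
  · rw [← e]
    exact hc.conj_pow _

variable (D c) in
/-- Shifting the exponent. -/
def shift : Equiv.Perm (NF D c) where
  toFun p := ⟨(p.1.1 + 1, p.1.2), p.2⟩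
  invFun p := ⟨(p.1.1 - 1, p.1.2), p.2⟩
  left_inv p := by simp
  right_inv p := by simp

theorem act_top (p : NF D c) : I.act c (pre_refl c) p = shift D c p := by
  refine Subtype.ext ?_
  change strip _ _ _ = (p.1.1 + 1, p.1.2)
  rw [show c ^ (-p.1.1) * c * c ^ p.1.1 = c by group, I.ins_top p.2.1, strip_cons_top,
    strip_eq_self p.2.2]

/-- Both complements of `y` in `c` are in the interval: `c * y⁻¹` on the left and `y⁻¹ * c` on the
right. The two composites with `y` are the action of `c`, which is the invertible shift. -/
theorem act_bijective {y : G} (hy : D.Pre y c) : Function.Bijective (I.act y hy) := by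
  constructor
  · intro p q h
    have key : ∀ r, I.act (c * y⁻¹) hy.mul_inv_pre (I.act y hy r) = shift D c r := fun r => by
      rw [← I.act_top]
      have h1 : D.Pre (c * y⁻¹) (c * y⁻¹ * y) := by simpa using hy.mul_inv_pre
      have := I.act_act h1 (by simpa using pre_refl c) r
      simpa using this
    exact (shift D c).injective (by rw [← key, ← key, h])
  · intro q
    have h1 : D.Pre y (y * (y⁻¹ * c)) := by simpa using hy
    have := I.act_act h1 (by simpa using pre_refl c) ((shift D c).symm q)
    refine ⟨_, this.trans ?_⟩
    have e := I.act_top ((shift D c).symm q)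
    rw [Equiv.apply_symm_apply] at e
    simpa using e

/-- The action as a permutation. -/
noncomputable def actPerm (y : G) (hy : D.Pre y c) : Equiv.Perm (NF D c) :=
  Equiv.ofBijective _ (I.act_bijective hy)

theorem actPerm_mul {x y : G} (hxy : D.Pre x (x * y)) (hc : D.Pre (x * y) c) :
    I.actPerm (x * y) hc =
      I.actPerm x (hxy.trans hc) * I.actPerm y (hxy.right_pre.trans hc) :=
  Equiv.ext fun p => (I.act_act hxy hc p).symm

theorem toNF_zero_injective {L M : List G} (hL : D.Normal c L) (hM : D.Normal c M)
    (h : toNF 0 L hL = toNF 0 M hM) : L = M := by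
  obtain ⟨a, L', rfl, -, -, h1⟩ := exists_strip hL 0
  obtain ⟨b, M', rfl, -, -, h2⟩ := exists_strip hM 0
  have := Subtype.ext_iff.mp h
  change strip _ _ _ = strip _ _ _ at this
  rw [h1, h2, Prod.mk.injEq] at this
  obtain ⟨hab, rfl⟩ := this
  have : a = b := by omega
  rw [this]

end MeetInterval
end LengthFn
end BandBraid

namespace BandBraid
open Equiv Equiv.Perm

/-! ### Reflection length and cycles -/

section PermLength
variable {α : Type*}

/-- The rational functions invariant under a permutation. -/
def fixSpace (w : Perm α) : Submodule ℚ (α → ℚ) where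
  carrier := {f | ∀ x, f (w x) = f x}
  add_mem' := fun hf hg x => by simp [hf x, hg x]
  zero_mem' := fun x => rfl
  smul_mem' := fun a f hf x => by simp [hf x]

theorem mem_fixSpace {w : Perm α} {f : α → ℚ} : f ∈ fixSpace w ↔ ∀ x, f (w x) = f x := Iff.rfl

variable [Fintype α]

theorem finrank_fixSpace_le (w : Perm α) : Module.finrank ℚ (fixSpace w) ≤ Fintype.card α := by
  simpa using Submodule.finrank_le (fixSpace w)

/-- The codimension of the space of invariants of a permutation, that is, its reflection length. -/
noncomputable def reflLen (w : Perm α) : ℕ := Fintype.card α - Module.finrank ℚ (fixSpace w)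

theorem reflLen_mul_le (x y : Perm α) : reflLen (x * y) ≤ reflLen x + reflLen y := by
  have h1 : fixSpace x ⊓ fixSpace y ≤ fixSpace (x * y) := fun f hf a => by
    rw [Perm.mul_apply, hf.1, hf.2]
  have h2 := Submodule.finrank_mono h1
  have h3 := Submodule.finrank_sup_add_finrank_inf_eq (fixSpace x) (fixSpace y)
  have h4 := Submodule.finrank_le (fixSpace x ⊔ fixSpace y)
  simp only [Module.finrank_fintype_fun_eq_card] at h4
  have := finrank_fixSpace_le x
  have := finrank_fixSpace_le y
  have := finrank_fixSpace_le (x * y)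
  unfold reflLen
  omega

theorem reflLen_one : reflLen (1 : Perm α) = 0 := by
  have : fixSpace (1 : Perm α) = ⊤ := eq_top_iff.mpr fun f _ x => rfl
  rw [reflLen, this, finrank_top, Module.finrank_fintype_fun_eq_card, Nat.sub_self]

theorem eq_one_of_reflLen_eq_zero (w : Perm α) (h : reflLen w = 0) : w = 1 := by
  have h1 := finrank_fixSpace_le w
  have h2 : fixSpace w = ⊤ := Submodule.eq_top_of_finrank_eq (by
    rw [Module.finrank_fintype_fun_eq_card]
    unfold reflLen at h
    omega)
  refine Equiv.ext fun x => ?_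
  classical
  have h3 : Pi.single x (1 : ℚ) ∈ fixSpace w := h2 ▸ Submodule.mem_top
  have h4 := h3 x
  by_contra h5
  rw [Pi.single_eq_same, Pi.single_eq_of_ne (show w x ≠ x from h5)] at h4
  exact zero_ne_one h4

theorem reflLen_conj (x y : Perm α) : reflLen (y * x * y⁻¹) = reflLen x := by
  have : (fixSpace (y * x * y⁻¹)).map (LinearEquiv.funCongrLeft ℚ ℚ y).toLinearMap =
      fixSpace x := by
    ext f
    simp only [Submodule.mem_map, LinearEquiv.coe_coe, mem_fixSpace]
    constructor
    · rintro ⟨g, hg, rfl⟩ a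
      simpa [LinearEquiv.funCongrLeft_apply, LinearMap.funLeft_apply] using hg (y a)
    · intro hf
      refine ⟨f ∘ y.symm, fun a => ?_, ?_⟩
      · simpa using hf (y.symm a)
      · ext a
        simp [LinearEquiv.funCongrLeft_apply, LinearMap.funLeft_apply]
  rw [reflLen, reflLen, ← this, LinearEquiv.finrank_map_eq]

/-- The reflection length on a symmetric group. -/
noncomputable def permLength (α : Type*) [Fintype α] : LengthFn (Perm α) where
  len := reflLen
  len_one := reflLen_one
  eq_one_of_len_eq_zero := eq_one_of_reflLen_eq_zero
  len_mul_le := reflLen_mul_le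
  len_conj := reflLen_conj

variable {w : Perm α} {i j k l : α}

theorem mem_of_sameCycle {S : Set α} (hS : ∀ x ∈ S, w x ∈ S) (h : SameCycle w i j) (hi : i ∈ S) :
    j ∈ S := by
  obtain ⟨m, -, rfl⟩ := h.exists_pow_eq'
  induction m with
  | zero => exact hi
  | succ m ih =>
    rw [pow_succ', Perm.mul_apply]
    exact hS _ (ih ⟨m, rfl⟩)

variable [DecidableEq α]

theorem reflLen_swap_le (i j : α) : reflLen (swap i j) ≤ 1 := by
  let φ : (α → ℚ) →ₗ[ℚ] ℚ := 
    LinearMap.proj (R := ℚ) (φ := fun _ => ℚ) i - LinearMap.proj (R := ℚ) (φ := fun _ => ℚ) j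
  have h1 : LinearMap.ker φ ≤ fixSpace (swap i j) := fun f hf a => by
    have hf' : f i = f j := by simpa [φ, sub_eq_zero] using hf
    by_cases hi : a = i
    · simp [hi, hf']
    by_cases hj : a = j
    · simp [hj, hf']
    rw [swap_apply_of_ne_of_ne hi hj]
  have h2 := Submodule.finrank_mono h1
  have h3 := LinearMap.finrank_range_add_finrank_ker φ
  have h4 := Submodule.finrank_le (LinearMap.range φ)
  simp only [Module.finrank_fintype_fun_eq_card, Module.finrank_self] at h3 h4
  unfold reflLen
  omega

/-- The arc `i, w i, …` stopping just before the first visit to `j` is closed under `swap i j * w`,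
which sends its last point back to `i`. -/
theorem not_sameCycle_swap_mul (hij : i ≠ j) (h : SameCycle w i j) :
    ¬SameCycle (swap i j * w) i j := by
  intro h'
  have hex : ∃ m, (w ^ m) i = j := by
    obtain ⟨m, -, hm⟩ := h.exists_pow_eq'
    exact ⟨m, hm⟩
  classical
  let m := Nat.find hex
  have hm : (w ^ m) i = j := Nat.find_spec hex
  have hmin : ∀ a < m, (w ^ a) i ≠ j := fun a ha => Nat.find_min hex ha
  have hm0 : 0 < m := Nat.pos_of_ne_zero fun h0 => hij (by simpa [h0] using hm)
  have hi : ∀ a, 0 < a → a < m → (w ^ a) i ≠ i := fun a h0 ha hai => by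
    refine hmin (m - a) (by omega) ?_
    rw [← hm]
    conv_rhs => rw [show m = (m - a) + a by omega, pow_add, Perm.mul_apply, hai]
  have := mem_of_sameCycle (S := {x | ∃ a < m, (w ^ a) i = x}) ?_ h' ⟨0, hm0, rfl⟩
  · obtain ⟨a, ha, haj⟩ := this
    exact hmin a ha haj
  · rintro _ ⟨a, ha, rfl⟩
    rw [Perm.mul_apply, ← Perm.mul_apply w, ← pow_succ']
    rcases (Nat.succ_le_of_lt ha).lt_or_eq with h1 | h1
    · rw [swap_apply_of_ne_of_ne (hi _ (Nat.succ_pos a) h1) (hmin _ h1)]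
      exact ⟨_, h1, rfl⟩
    · rw [show a + 1 = m from h1, hm, swap_apply_right]
      exact ⟨0, hm0, rfl⟩

/-- The new permutation follows the `w`-cycle of `i` as far as `w⁻¹ i` and then jumps to `j`. -/
theorem sameCycle_swap_mul (h : ¬SameCycle w i j) : SameCycle (swap i j * w) i j := by
  by_contra hC
  have key := mem_of_sameCycle (w := w) (i := i) (j := w.symm i)
    (S := {x | SameCycle (swap i j * w) i x ∧ SameCycle w i x}) ?_
    (sameCycle_symm_apply_right.mpr (SameCycle.refl _ _))
    ⟨SameCycle.refl _ _, SameCycle.refl _ _⟩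
  · refine hC (key.1.trans ?_)
    have : SameCycle (swap i j * w) (w.symm i) ((swap i j * w) (w.symm i)) :=
      sameCycle_apply_right.mpr (SameCycle.refl _ _)
    rwa [Perm.mul_apply, Equiv.apply_symm_apply, swap_apply_left] at this
  · rintro x ⟨h1, h2⟩
    have hx : SameCycle w i (w x) := by simpa using h2
    refine ⟨?_, hx⟩
    have hj : w x ≠ j := fun e => h (e ▸ hx)
    have h3 : SameCycle (swap i j * w) i ((swap i j * w) x) := by
      rwa [sameCycle_apply_right]
    rw [Perm.mul_apply] at h3
    by_cases hi : w x = i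
    · rw [hi]
    · rwa [swap_apply_of_ne_of_ne hi hj] at h3

/-- Every `w`-invariant function takes equal values at `i` and `j`, so it stays invariant; the
indicator of the new cycle of `i` is a further invariant. The length thus drops, and by at most one,
since a transposition has length at most one. -/
theorem reflLen_swap_mul (hij : i ≠ j) (h : SameCycle w i j) :
    reflLen (swap i j * w) + 1 = reflLen w := by
  have hw : ∀ f ∈ fixSpace w, ∀ x y, SameCycle w x y → f x = f y := fun f hf x y hxy =>
    mem_of_sameCycle (S := {z | f x = f z}) (fun z hz => by
      rw [Set.mem_ofPred_eq] at hz ⊢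
      rw [hz, hf]) hxy rfl
  have hlt : fixSpace w < fixSpace (swap i j * w) := by
    refine lt_of_le_of_ne (fun f hf x => ?_) fun e => ?_
    · rw [Perm.mul_apply, ← hf x]
      have := hw f hf i j h
      by_cases hi : w x = i
      · rw [hi, swap_apply_left, this]
      by_cases hj : w x = j
      · rw [hj, swap_apply_right, this]
      rw [swap_apply_of_ne_of_ne hi hj]
    · classical
      let f : α → ℚ := fun x => if SameCycle (swap i j * w) i x then 1 else 0
      have hf : f ∈ fixSpace w := by
        rw [e]
        intro x
        simp only [f, sameCycle_apply_right]
      have := hw f hf i j h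
      simp only [f, if_pos (SameCycle.refl _ _), if_neg (not_sameCycle_swap_mul hij h)] at this
      exact one_ne_zero this
  have h1 := Submodule.finrank_lt_finrank_of_lt hlt
  have h2 := finrank_fixSpace_le w
  have h3 := finrank_fixSpace_le (swap i j * w)
  have h4 := reflLen_mul_le (swap i j) (swap i j * w)
  have h5 := reflLen_swap_le i j
  rw [swap_mul_self_mul] at h4
  unfold reflLen at *
  omega

theorem reflLen_swap_mul_of_not_sameCycle (h : ¬SameCycle w i j) :
    reflLen (swap i j * w) = reflLen w + 1 := by
  have hij : i ≠ j := by
    rintro rfl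
    exact h (SameCycle.refl _ _)
  have := reflLen_swap_mul hij (sameCycle_swap_mul h)
  rw [swap_mul_self_mul] at this
  exact this.symm

theorem reflLen_swap (hij : i ≠ j) : reflLen (swap i j) = 1 := by
  have := reflLen_swap_mul_of_not_sameCycle (w := 1) (i := i) (j := j) (by simpa using hij)
  simpa [reflLen_one] using this

/-- A transposition is a prefix of a permutation iff it moves points along a cycle. -/
theorem swap_pre_iff (hij : i ≠ j) : (permLength α).Pre (swap i j) w ↔ SameCycle w i j := by
  change reflLen (swap i j) + reflLen ((swap i j)⁻¹ * w) = reflLen w ↔ _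
  rw [swap_inv, reflLen_swap hij]
  refine ⟨fun h => ?_, fun h => ?_⟩
  · by_contra h'
    have := reflLen_swap_mul_of_not_sameCycle h'
    omega
  · have := reflLen_swap_mul hij h
    omega

theorem sameCycle_swap_mul_or (h : SameCycle w i k) :
    SameCycle (swap i j * w) i k ∨ SameCycle (swap i j * w) j k := by
  refine mem_of_sameCycle
    (S := {x | SameCycle (swap i j * w) i x ∨ SameCycle (swap i j * w) j x}) ?_ h
    (Or.inl (SameCycle.refl _ _))
  intro x hx
  by_cases hi : w x = i
  · rw [hi]
    exact Or.inl (SameCycle.refl _ _)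
  by_cases hj : w x = j
  · rw [hj]
    exact Or.inr (SameCycle.refl _ _)
  have : (swap i j * w) x = w x := by rw [Perm.mul_apply, swap_apply_of_ne_of_ne hi hj]
  rw [Set.mem_ofPred_eq, ← this, sameCycle_apply_right, sameCycle_apply_right]
  exact hx

theorem sameCycle_swap_mul_of_not (hi : ¬SameCycle w k i) (hj : ¬SameCycle w k j)
    (h : SameCycle w k l) : SameCycle (swap i j * w) k l := by
  refine (mem_of_sameCycle (S := {x | SameCycle (swap i j * w) k x ∧ SameCycle w k x}) ?_ h
    ⟨SameCycle.refl _ _, SameCycle.refl _ _⟩).1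
  rintro x ⟨h1, h2⟩
  have h3 : SameCycle w k (w x) := by rwa [sameCycle_apply_right]
  have hxi : w x ≠ i := fun e => hi (e ▸ h3)
  have hxj : w x ≠ j := fun e => hj (e ▸ h3)
  have : (swap i j * w) x = w x := by rw [Perm.mul_apply, swap_apply_of_ne_of_ne hxi hxj]
  refine ⟨?_, h3⟩
  rwa [← this, sameCycle_apply_right]

end PermLength

/-! ### Noncrossing permutations: prefixes of the long cycle -/

/-- The point `i` of the set `{0, …, n}`. -/
def pt (n i : ℕ) : Fin (n + 1) := Fin.ofNat (n + 1) i

theorem pt_val {n i : ℕ} (h : i ≤ n) : (pt n i).val = i := Nat.mod_eq_of_lt (by omega)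

/-- The permutation `(m m-1 ⋯ 1)` as a product of simple transpositions. -/
def cyc (n m : ℕ) : Perm (Fin (n + 1)) :=
  ((List.Ico 1 m).reverse.map fun i => swap (pt n (i + 1)) (pt n i)).prod

theorem cyc_succ (n m : ℕ) (hm : 1 ≤ m) :
    cyc n (m + 1) = swap (pt n (m + 1)) (pt n m) * cyc n m := by
  simp [cyc, List.Ico.succ_top hm]

theorem cyc_apply (n m : ℕ) (hm : 1 ≤ m) (hmn : m ≤ n) (x : Fin (n + 1)) :
    (cyc n m x).val =
      if x.val = 0 then 0 else if x.val = 1 then m else if x.val ≤ m then x.val - 1 else x.val := by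
  induction m, hm using Nat.le_induction generalizing x with
  | base =>
    simp only [cyc, List.Ico.self_empty, List.reverse_nil, List.map_nil, List.prod_nil,
      Perm.one_apply]
    split_ifs <;> omega
  | succ m hm ih =>
    have ih := ih (by omega) x
    rw [cyc_succ n m hm, Perm.mul_apply, swap_apply_def]
    generalize cyc n m x = y at *
    have h1 : (pt n m).val = m := pt_val (by omega)
    have h2 : (pt n (m + 1)).val = m + 1 := pt_val hmn
    simp only [Fin.ext_iff, h1, h2]
    split_ifs at ih ⊢ <;> (try simp only [h1, h2]) <;> omega

section Noncrossing
variable {n : ℕ}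

local notation "Pr" => LengthFn.Pre (permLength (Fin (n + 1)))

theorem cyc_top_apply_of_pos {x : Fin (n + 1)} (hx : 1 < x.val) :
    (cyc n n x).val = x.val - 1 := by
  have := x.isLt
  rw [cyc_apply n n (by omega) le_rfl, if_neg (by omega), if_neg (by omega), if_pos (by omega)]

/-- Splitting the long cycle at two points separates the two arcs. -/
theorem mem_Ioc_of_sameCycle {p q x y : Fin (n + 1)} (hp : 0 < p) (hpq : p < q)
    (h : SameCycle (swap q p * cyc n n) x y) (hx : x ∈ Set.Ioc p q) : y ∈ Set.Ioc p q := by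
  refine mem_of_sameCycle (fun z hz => ?_) h hx
  obtain ⟨h1, h2⟩ := hz
  have hz : (cyc n n z).val = z.val - 1 := cyc_top_apply_of_pos (by omega)
  rw [Perm.mul_apply, swap_apply_def]
  split_ifs with e1 e2
  · rw [e1] at hz
    exact absurd hz (by omega)
  · exact ⟨hpq, le_rfl⟩
  · rw [Fin.ext_iff] at e1 e2
    constructor <;> [rw [Fin.lt_def]; rw [Fin.le_def]] <;> omega

/-- Two points on a cycle of `swap q p * w` give a transposition below it, hence below `swap q p *
cyc n n`. So the separation of arcs passes from the long cycle to its prefixes. -/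
theorem mem_Ioc_iff_of_pre {p q x y : Fin (n + 1)} {w : Perm (Fin (n + 1))} (hw : Pr w (cyc n n))
    (hp : 0 < p) (hpq : p < q) (hqp : Pr (swap q p) w) (h : SameCycle (swap q p * w) x y) :
    x ∈ Set.Ioc p q ↔ y ∈ Set.Ioc p q := by
  by_cases hxy : x = y
  · rw [hxy]
  have h1 : Pr (swap x y) (swap q p * cyc n n) := by
    have := ((swap_pre_iff hxy).mpr h).trans ((swap_inv q p) ▸ hqp.inv_mul hw)
    exact this
  have h2 := (swap_pre_iff hxy).mp h1
  exact ⟨mem_Ioc_of_sameCycle hp hpq h2, mem_Ioc_of_sameCycle hp hpq h2.symm⟩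

theorem swap_mul_pre {x y z t : Fin (n + 1)} {w : Perm (Fin (n + 1))} (hxy : x ≠ y)
    (h1 : SameCycle w x y) (h2 : Pr (swap z t) (swap x y * w)) : Pr (swap x y * swap z t) w :=
  ((swap_pre_iff hxy).mpr h1).mul_pre (by rwa [swap_inv])

/-- Cutting along the chord `r q` leaves `p` on the cycle of `q`, since `r` and `p` lie on different
sides of that chord. -/
theorem triangle_pre {p q r : Fin (n + 1)} {w : Perm (Fin (n + 1))} (hw : Pr w (cyc n n))
    (hp : 0 < p) (hpq : p < q) (hqr : q < r) (h1 : SameCycle w p q) (h2 : SameCycle w q r) :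
    Pr (swap r q * swap q p) w := by
  refine swap_mul_pre hqr.ne' h2.symm ((swap_pre_iff hpq.ne').mpr ?_)
  rcases sameCycle_swap_mul_or (j := q) (h2.symm.trans h1.symm) with h | h
  · have := mem_Ioc_iff_of_pre hw (hp.trans hpq) hqr ((swap_pre_iff hqr.ne').mpr h2.symm) h
    simp only [Set.mem_Ioc, hqr, le_refl, true_and, true_iff] at this
    exact absurd this.1 hpq.not_gt
  · exact h

/-- Two noncrossing chords below `w` have product below `w`. -/
theorem noncrossing_pre {p q x y : Fin (n + 1)} {w : Perm (Fin (n + 1))} (hw : Pr w (cyc n n))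
    (hp : 0 < p) (hpq : p < q) (hxy : y ≠ x) (hside : x ∈ Set.Ioo p q ↔ y ∈ Set.Ioo p q)
    (hx : x ≠ p ∧ x ≠ q) (hy : y ≠ p ∧ y ≠ q)
    (h1 : SameCycle w q p) (h2 : SameCycle w y x) : Pr (swap q p * swap y x) w := by
  refine swap_mul_pre hpq.ne' h1 ((swap_pre_iff hxy).mpr ?_)
  have hqp := (swap_pre_iff hpq.ne').mpr h1
  have hIoc : ∀ z, z ≠ p → z ≠ q → (z ∈ Set.Ioo p q ↔ z ∈ Set.Ioc p q) := fun z h1 h2 =>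
    ⟨fun h => ⟨h.1, h.2.le⟩, fun h => ⟨h.1, lt_of_le_of_ne h.2 h2⟩⟩
  rw [hIoc x hx.1 hx.2, hIoc y hy.1 hy.2] at hside
  have hq : q ∈ Set.Ioc p q := ⟨hpq, le_rfl⟩
  have hp' : p ∉ Set.Ioc p q := fun h => lt_irrefl _ h.1
  -- If both chords lie on one cycle, cutting along `q p` splits it exactly into its points inside
  -- and outside the arc, and `x`, `y` are on the same side. Otherwise the cut does not touch the
  -- cycle of `x` and `y`.
  by_cases hc : SameCycle w q x
  · have key : ∀ z, SameCycle w q z → z ∈ Set.Ioc p q ∧ SameCycle (swap q p * w) q z ∨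
        z ∉ Set.Ioc p q ∧ SameCycle (swap q p * w) p z := fun z hz => by
      rcases sameCycle_swap_mul_or (j := p) hz with h | h
      · exact Or.inl ⟨(mem_Ioc_iff_of_pre hw hp hpq hqp h).mp hq, h⟩
      · exact Or.inr ⟨fun h' => hp' ((mem_Ioc_iff_of_pre hw hp hpq hqp h).mpr h'), h⟩
    rcases key x hc with ⟨a1, a2⟩ | ⟨a1, a2⟩ <;>
      rcases key y (hc.trans h2.symm) with ⟨b1, b2⟩ | ⟨b1, b2⟩
    · exact b2.symm.trans a2
    · exact absurd (hside.mp a1) b1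
    · exact absurd (hside.mpr b1) a1
    · exact b2.symm.trans a2
  · have hc1 : ¬SameCycle w y q := fun h => hc (h.symm.trans h2)
    exact sameCycle_swap_mul_of_not hc1 (fun h => hc1 (h.trans h1.symm)) h2

/-- Crossing chords below `w` have all their end points on the same cycle. -/
theorem sameCycle_of_crossing {p q r m : Fin (n + 1)} {w : Perm (Fin (n + 1))}
    (hw : Pr w (cyc n n)) (hp : 0 < p) (hpq : p < q) (hqr : q < r) (hrm : r < m)
    (h1 : SameCycle w r p) (h2 : SameCycle w m q) : SameCycle w q p := by
  by_contra h
  -- If `q` were on another cycle, cutting along `r p` would keep `q` and `m` together, although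
  -- they lie on different sides of this chord.
  have h3 := sameCycle_swap_mul_of_not (fun h' => h (h'.trans h1)) h h2.symm
  have := (mem_Ioc_iff_of_pre hw hp (hpq.trans hqr)
    ((swap_pre_iff (hpq.trans hqr).ne').mpr h1) h3).mp ⟨hpq, hqr.le⟩
  exact absurd this.2 hrm.not_ge

theorem reflLen_cyc (m : ℕ) (hm : 1 ≤ m) (hmn : m ≤ n) : reflLen (cyc n m) = m - 1 := by
  induction m, hm using Nat.le_induction with
  | base => simp [cyc, reflLen_one]
  | succ m hm ih =>
    rw [cyc_succ n m hm, reflLen_swap_mul_of_not_sameCycle, ih (by omega)]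
    · omega
    · intro h
      have h1 : (pt n m).val = m := pt_val (by omega)
      have h2 : (pt n (m + 1)).val = m + 1 := pt_val hmn
      have := mem_of_sameCycle (S := {pt n (m + 1)}) ?_ h rfl
      · have := congrArg Fin.val (Set.mem_singleton_iff.mp this)
        omega
      · rintro _ rfl
        rw [Set.mem_singleton_iff, Fin.ext_iff, cyc_apply n m hm (by omega), h2,
          if_neg (by omega), if_neg (by omega), if_neg (by omega)]

theorem sameCycle_cyc {x y : Fin (n + 1)} (hx : 0 < x) (hy : 0 < y) : SameCycle (cyc n n) x y := by
  have key : ∀ k, ∀ z : Fin (n + 1), z.val = k + 1 →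
      SameCycle (cyc n n) z (pt n 1) := by
    intro k
    induction k with
    | zero =>
      intro z hz
      have : z = pt n 1 := by
        rw [Fin.ext_iff, hz, pt_val (by have := z.isLt; omega)]
      rw [this]
    | succ k ih =>
      intro z hz
      rw [← sameCycle_apply_left]
      exact ih _ (by rw [cyc_top_apply_of_pos (by omega)]; omega)
  exact (key (x.val - 1) x (by rw [Fin.lt_def] at hx; simp at hx; omega)).trans
    (key (y.val - 1) y (by rw [Fin.lt_def] at hy; simp at hy; omega)).symm

/-- The point `0` is an idle extra one, so that strands keep their labels `1, …, n`. -/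
theorem cyc_zero : cyc n n 0 = 0 := by
  rcases Nat.eq_zero_or_pos n with rfl | h
  · exact Subsingleton.elim (α := Fin 1) _ _
  · rw [Fin.ext_iff, cyc_apply n n h le_rfl]
    simp

theorem not_sameCycle_cyc_zero {x : Fin (n + 1)} (hx : 0 < x) : ¬SameCycle (cyc n n) 0 x := by
  intro h
  have := mem_of_sameCycle (S := {0}) (by simp [cyc_zero]) h rfl
  exact hx.ne' this

end Noncrossing
end BandBraid

/-! ### Relations between band generators -/

namespace BandBraid

variable {n : ℕ}

theorem sigma_comm {i j : ℕ} (h : i + 1 < j) : Commute (sigma n i) (sigma n j) := by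
  unfold sigma
  split_ifs with h1 h2 <;> try simp
  have h3 : (FreeGroup.of ⟨i, h1⟩ * FreeGroup.of ⟨j, h2⟩) *
      (FreeGroup.of ⟨j, h2⟩ * FreeGroup.of ⟨i, h1⟩)⁻¹ ∈ artinRelators n := by
    refine Or.inl ⟨⟨i, h1⟩, ⟨j, h2⟩, ?_, rfl⟩
    rw [lt_abs]
    right
    push_cast
    omega
  have := PresentedGroup.one_of_mem h3
  rw [map_mul, map_inv, mul_inv_eq_one] at this
  exact this

theorem sigma_braid {i : ℕ} (h0 : 1 ≤ i) (h : i + 1 < n) :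
    sigma n i * sigma n (i + 1) * sigma n i = sigma n (i + 1) * sigma n i * sigma n (i + 1) := by
  have h1 : 1 ≤ i ∧ i < n := ⟨h0, by omega⟩
  have h2 : 1 ≤ i + 1 ∧ i + 1 < n := ⟨by omega, h⟩
  simp only [sigma, dif_pos h1, dif_pos h2]
  have h3 : (FreeGroup.of ⟨i, h1⟩ * FreeGroup.of ⟨i + 1, h2⟩ * FreeGroup.of ⟨i, h1⟩) *
      (FreeGroup.of ⟨i + 1, h2⟩ * FreeGroup.of ⟨i, h1⟩ * FreeGroup.of ⟨i + 1, h2⟩)⁻¹ ∈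
        artinRelators n := by
    refine Or.inr ⟨⟨i, h1⟩, ⟨i + 1, h2⟩, ?_, rfl⟩
    push_cast
    simp
  have := PresentedGroup.one_of_mem h3
  rw [map_mul, map_inv, mul_inv_eq_one] at this
  exact this

theorem sigmaDesc_self (t : ℕ) : sigmaDesc n t t = 1 := by simp [sigmaDesc]

theorem sigmaDesc_succ_top {t s : ℕ} (h : s ≤ t) :
    sigmaDesc n (t + 1) s = sigma n t * sigmaDesc n t s := by
  simp [sigmaDesc, List.Ico.succ_top h]

theorem sigmaDesc_mul {t r s : ℕ} (h1 : s ≤ r) (h2 : r ≤ t) :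
    sigmaDesc n t r * sigmaDesc n r s = sigmaDesc n t s := by
  induction t, h2 using Nat.le_induction with
  | base => simp [sigmaDesc_self]
  | succ t ht ih =>
    rw [sigmaDesc_succ_top ht, sigmaDesc_succ_top (h1.trans ht), mul_assoc, ih]

theorem band_succ_self (s : ℕ) : band n (s + 1) s = sigma n s := by
  simp [band, sigmaDesc_self]

theorem band_succ {t s : ℕ} (h : s < t) :
    band n (t + 1) s = sigma n t * band n t s * (sigma n t)⁻¹ := by
  rw [band, band, sigmaDesc_succ_top h]
  group

theorem sigmaDesc_commute {t s : ℕ} (x : Braid n) (h : s ≤ t)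
    (hx : ∀ i, s ≤ i → i < t → Commute (sigma n i) x) : Commute (sigmaDesc n t s) x := by
  induction t, h using Nat.le_induction with
  | base => simp [sigmaDesc_self]
  | succ t ht ih =>
    rw [sigmaDesc_succ_top ht]
    exact (hx t ht (by omega)).mul_left (ih fun i h1 h2 => hx i h1 (by omega))

theorem band_commute {t s : ℕ} (x : Braid n) (h : s < t)
    (hx : ∀ i, s ≤ i → i < t → Commute (sigma n i) x) : Commute (band n t s) x := by
  have h1 := sigmaDesc_commute x (Nat.succ_le_of_lt h) fun i a b => hx i (by omega) b
  exact (h1.mul_left (hx s le_rfl h)).mul_left h1.inv_left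

theorem sigma_commute_band {i t s : ℕ} (h : s < t) (hi : t < i ∨ i + 1 < s) :
    Commute (sigma n i) (band n t s) := by
  refine (band_commute _ h fun j h1 h2 => ?_).symm
  rcases hi with hi | hi
  · exact sigma_comm (by omega)
  · exact (sigma_comm (by omega)).symm

/-- Bands over disjoint intervals commute. -/
theorem band_commute_of_disjoint {p q r m : ℕ} (hpq : p < q) (hqr : q < r) (hrm : r < m) :
    Commute (band n m r) (band n q p) :=
  band_commute _ hrm fun _ h1 _ => sigma_commute_band hpq (Or.inl (by omega))

theorem sigmaDesc_commute_band {p q t : ℕ} (hpq : p < q) (h : q + 1 ≤ t) :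
    Commute (sigmaDesc n t (q + 1)) (band n q p) :=
  sigmaDesc_commute _ h fun _ h1 _ => sigma_commute_band hpq (Or.inl (by omega))

theorem band_eq_sigmaDesc_conj {p q t : ℕ} (hpq : p < q) (h : q ≤ t) :
    band n t p = sigmaDesc n t q * band n q p * (sigmaDesc n t q)⁻¹ := by
  rw [band, band, ← sigmaDesc_mul (Nat.succ_le_of_lt hpq) h]
  group

/-- Conjugation by `a_{rq}` takes `a_{qp}` to `a_{rp}`: the inner factor `(σ_{r-1} ⋯ σ_{q+1})⁻¹`
commutes with `a_{qp}`, and what remains is conjugation by `σ_{r-1} ⋯ σ_q`. -/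
theorem band_mul_band {p q r : ℕ} (hpq : p < q) (hqr : q < r) :
    band n r q * band n q p = band n r p * band n r q := by
  have h1 : sigmaDesc n r q = sigmaDesc n r (q + 1) * sigma n q := by
    rw [← sigmaDesc_mul (Nat.le_succ q) hqr, sigmaDesc_succ_top le_rfl, sigmaDesc_self, mul_one]
  have h2 : (sigmaDesc n r (q + 1))⁻¹ * band n q p * sigmaDesc n r (q + 1) = band n q p := by
    rw [mul_assoc, ← (sigmaDesc_commute_band hpq hqr).eq, inv_mul_cancel_left]
  have h3 : band n r q * band n q p * (band n r q)⁻¹ = sigmaDesc n r (q + 1) * sigma n q *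
      ((sigmaDesc n r (q + 1))⁻¹ * band n q p * sigmaDesc n r (q + 1)) *
      (sigmaDesc n r (q + 1) * sigma n q)⁻¹ := by
    rw [band]
    group
  rw [h2, ← h1, ← band_eq_sigmaDesc_conj hpq hqr.le] at h3
  exact mul_inv_eq_iff_eq_mul.mp h3

/-- In the inductive step, undoing the conjugation by `x = σ_q` turns `y = σ_{q+1}` into `x⁻¹ y x =
y x y⁻¹`. As `y` commutes with `a = a_{qp}`, the claim is the `y`-conjugate of the braid relation
between `x` and `a`. -/
theorem sigma_band_braid {p q : ℕ} (hp : 1 ≤ p) (hpq : p < q) (hq : q < n) :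
    sigma n q * band n q p * sigma n q = band n q p * sigma n q * band n q p := by
  induction q, hpq using Nat.le_induction with
  | base => rw [band_succ_self, sigma_braid hp hq]
  | succ q hpq ih =>
    have ih := ih (by omega)
    have hb := sigma_braid (n := n) (i := q) (by omega) hq
    have hc : Commute (sigma n (q + 1)) (band n q p) :=
      sigma_commute_band hpq (Or.inl (by omega))
    rw [band_succ hpq]
    generalize sigma n (q + 1) = y at *
    generalize sigma n q = x at *
    generalize band n q p = a at *
    have e1 : x⁻¹ * y * x = y * x * y⁻¹ := by
      rw [eq_mul_inv_iff_mul_eq, mul_assoc, mul_assoc, inv_mul_eq_iff_eq_mul, ← mul_assoc,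
        ← mul_assoc, hb]
    have e2 : a = y * a * y⁻¹ := by rw [hc.eq, mul_inv_cancel_right]
    have e3 : (x⁻¹ * y * x) * a * (x⁻¹ * y * x) = a * (x⁻¹ * y * x) * a := by
      rw [e1, e2]
      calc y * x * y⁻¹ * (y * a * y⁻¹) * (y * x * y⁻¹) = y * (x * a * x) * y⁻¹ := by group
        _ = y * (a * x * a) * y⁻¹ := by rw [ih]
        _ = _ := by group
    calc y * (x * a * x⁻¹) * y = x * ((x⁻¹ * y * x) * a * (x⁻¹ * y * x)) * x⁻¹ := by group
      _ = x * (a * (x⁻¹ * y * x) * a) * x⁻¹ := by rw [e3]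
      _ = _ := by group

theorem band_mul_band' {p q r : ℕ} (hp : 1 ≤ p) (hpq : p < q) (hqr : q < r) (hr : r ≤ n) :
    band n r q * band n q p = band n q p * band n r p := by
  have hb := sigma_band_braid hp hpq (hqr.trans_le hr)
  have hd := (sigmaDesc_commute_band (n := n) hpq hqr).eq
  rw [band_eq_sigmaDesc_conj (p := p) (hpq.trans (Nat.lt_succ_self q)) hqr, band_succ hpq, band]
  generalize sigmaDesc n r (q + 1) = d at *
  generalize sigma n q = x at *
  generalize band n q p = a at *
  have hd' : d⁻¹ * a = a * d⁻¹ := by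
    rw [inv_mul_eq_iff_eq_mul, ← mul_assoc, hd, mul_inv_cancel_right]
  calc d * x * d⁻¹ * a = d * (x * a * x) * x⁻¹ * d⁻¹ := by
        rw [mul_assoc _ d⁻¹, hd']; group
    _ = (d * a) * x * a * x⁻¹ * d⁻¹ := by rw [hb]; group
    _ = _ := by rw [hd]; group

/-- Bands over nested intervals commute. -/
theorem band_commute_of_nested {p q r m : ℕ} (hp : 1 ≤ p) (hpq : p < q) (hqr : q < r)
    (hrm : r < m) (hm : m ≤ n) : Commute (band n m p) (band n r q) := by
  induction m, hrm using Nat.le_induction with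
  | base =>
    have h1 := band_mul_band (n := n) hpq hqr
    have h2 := sigma_band_braid (n := n) (hp.trans hpq.le) hqr (by omega)
    have h3 : Commute (sigma n r) (band n q p) := sigma_commute_band hpq (Or.inl (by omega))
    rw [band_succ (hpq.trans hqr), ← mul_inv_eq_iff_eq_mul.mpr h1]
    generalize sigma n r = x at *
    generalize band n r q = a at *
    generalize band n q p = b at *
    -- Conjugation by `x * a` takes the commuting pair `b`, `x` to the long band and `a`.
    have e : (x * a)⁻¹ * a * (x * a) = x := by
      rw [mul_assoc, inv_mul_eq_iff_eq_mul, ← mul_assoc, h2]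
    have h4 : Commute b ((x * a)⁻¹ * a * (x * a)) := e.symm ▸ h3.symm
    change _ * _ = _ * _
    calc x * (a * b * a⁻¹) * x⁻¹ * a =
        (x * a) * (b * ((x * a)⁻¹ * a * (x * a))) * (x * a)⁻¹ := by group
      _ = _ := by rw [h4.eq]; group
  | succ m hm' ih =>
    have h : Commute (sigma n m) (band n r q) := sigma_commute_band hqr (Or.inl (by omega))
    rw [band_succ (by omega)]
    exact (h.mul_left (ih (by omega))).mul_left h.inv_left

end BandBraid

/-! ### The noncrossing interval as an atomic interval -/

namespace BandBraid
open Equiv Equiv.Perm LengthFn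

theorem LengthFn.Adj.symm {G H ι : Type*} [Group G] [Group H] {D : LengthFn G} {c : G} {τ : ι → G}
    {b : ι → H} {p q : ι} (h : D.Adj c τ b p q) : D.Adj c τ b q p := by
  obtain ⟨u, v, h1, h2, h3, h4, h5⟩ := h
  exact ⟨v, u, h1.symm, h2.symm, h4, h3, fun w hw hq hp => h1 ▸ h5 w hw hp hq⟩

variable {n : ℕ}

local notation "Pr" => LengthFn.Pre (permLength (Fin (n + 1)))

/-- The transposition exchanging `t` and `s`. -/
def tr (n t s : ℕ) : Perm (Fin (n + 1)) := swap (pt n t) (pt n s)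

theorem pt_lt {i j : ℕ} (h : i < j) (hj : j ≤ n) : pt n i < pt n j := by
  rw [Fin.lt_def, pt_val (by omega), pt_val hj]
  exact h

theorem pt_pos {i : ℕ} (h : 1 ≤ i) (hi : i ≤ n) : 0 < pt n i := by
  rw [Fin.lt_def, pt_val hi]
  exact h

theorem tr_pre_iff {t s : ℕ} (h : s < t) (ht : t ≤ n) {w : Perm (Fin (n + 1))} :
    Pr (tr n t s) w ↔ SameCycle w (pt n t) (pt n s) :=
  swap_pre_iff (pt_lt h ht).ne'

theorem tr_pre_cyc {t s : ℕ} (hs : 1 ≤ s) (h : s < t) (ht : t ≤ n) : Pr (tr n t s) (cyc n n) :=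
  (tr_pre_iff h ht).mpr (sameCycle_cyc (pt_pos (hs.trans h.le) ht) (pt_pos hs (h.le.trans ht)))

section Triangle
variable {p q r : ℕ} (hp : 1 ≤ p) (hpq : p < q) (hqr : q < r) (hr : r ≤ n)
include hpq hqr hr

theorem tr_mul_tr : tr n r q * tr n q p = tr n r p * tr n r q := by
  have h1 := (pt_lt hpq (hqr.le.trans hr)).ne
  have h2 := (pt_lt (hpq.trans hqr) hr).ne
  rw [tr, tr, tr, mul_swap_eq_swap_mul, swap_apply_right, swap_apply_of_ne_of_ne h2 h1]

theorem tr_mul_tr' : tr n r q * tr n q p = tr n q p * tr n r p := by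
  have h1 := (pt_lt hqr hr).ne'
  have h2 := (pt_lt (hpq.trans hqr) hr).ne'
  rw [tr, tr, tr, mul_swap_eq_swap_mul (swap (pt n q) (pt n p)), swap_apply_right,
    swap_apply_of_ne_of_ne h1 h2]

theorem sameCycle_tr_mul_tr : SameCycle (tr n r q * tr n q p) (pt n r) (pt n q) ∧
    SameCycle (tr n r q * tr n q p) (pt n q) (pt n p) := by
  have h1 := (pt_lt hqr hr).ne'
  have h2 := (pt_lt (hpq.trans hqr) hr).ne'
  have h3 := (pt_lt hpq (hqr.le.trans hr)).ne
  have e1 : (tr n r q * tr n q p) (pt n r) = pt n q := by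
    rw [Perm.mul_apply, tr, tr, swap_apply_of_ne_of_ne h1 h2, swap_apply_left]
  have e2 : (tr n r q * tr n q p) (pt n q) = pt n p := by
    rw [Perm.mul_apply, tr, tr, swap_apply_left, swap_apply_of_ne_of_ne h2.symm h3]
  constructor
  · conv_rhs => rw [← e1]
    exact sameCycle_apply_right.mpr (SameCycle.refl _ _)
  · conv_rhs => rw [← e2]
    exact sameCycle_apply_right.mpr (SameCycle.refl _ _)

theorem tr_pre_triangle : Pr (tr n r q) (tr n r q * tr n q p) ∧
    Pr (tr n q p) (tr n r q * tr n q p) ∧ Pr (tr n r p) (tr n r q * tr n q p) := by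
  obtain ⟨h1, h2⟩ := sameCycle_tr_mul_tr hpq hqr hr
  exact ⟨(tr_pre_iff hqr hr).mpr h1, (tr_pre_iff hpq (hqr.le.trans hr)).mpr h2,
    (tr_pre_iff (hpq.trans hqr) hr).mpr (h1.trans h2)⟩

include hp

theorem tr_mul_tr_pre {w : Perm (Fin (n + 1))} (hw : Pr w (cyc n n))
    (h1 : SameCycle w (pt n r) (pt n q)) (h2 : SameCycle w (pt n q) (pt n p)) :
    Pr (tr n r q * tr n q p) w :=
  triangle_pre hw (pt_pos hp (by omega)) (pt_lt hpq (by omega)) (pt_lt hqr hr) h2.symm h1.symm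

theorem tr_mul_tr_pre_cyc : Pr (tr n r q * tr n q p) (cyc n n) :=
  tr_mul_tr_pre hp hpq hqr hr (pre_refl _)
    (sameCycle_cyc (pt_pos (by omega) (by omega)) (pt_pos (by omega) (by omega)))
    (sameCycle_cyc (pt_pos (by omega) (by omega)) (pt_pos (by omega) (by omega)))

end Triangle

/-- The transposition of a band generator. -/
def bandPerm (p : BandIndex n) : Perm (Fin (n + 1)) := tr n p.1.1 p.1.2

/-- The band generator with a given index. -/
def bandOf (p : BandIndex n) : Braid n := band n p.1.1 p.1.2

local notation "BAdj" => LengthFn.Adj (permLength (Fin (n + 1))) (cyc n n) bandPerm bandOf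

section Pairs
variable {p q r m : ℕ}

/-- Any two sides of a triangle have the same 3-cycle as join. Its factorisations `a_{rq} a_{qp} =
a_{rp} a_{rq} = a_{qp} a_{rp}` provide the relation for each pair. -/
theorem adj_triangle (hp : 1 ≤ p) (hpq : p < q) (hqr : q < r) (hr : r ≤ n)
    (x y z : BandIndex n) (hx : x.1 = (r, q)) (hy : y.1 = (q, p)) (hz : z.1 = (r, p)) :
    BAdj x y ∧ BAdj x z ∧ BAdj y z := by
  obtain ⟨⟨x1, x2⟩, hx'⟩ := x
  obtain ⟨⟨y1, y2⟩, hy'⟩ := y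
  obtain ⟨⟨z1, z2⟩, hz'⟩ := z
  simp only [Prod.mk.injEq] at hx hy hz
  obtain ⟨rfl, rfl⟩ := hx
  obtain ⟨rfl, rfl⟩ := hy
  obtain ⟨rfl, rfl⟩ := hz
  obtain ⟨h1, h2, h3⟩ := tr_pre_triangle hpq hqr hr
  have e1 := tr_mul_tr hpq hqr hr
  have e2 := tr_mul_tr' hpq hqr hr
  have b1 := band_mul_band (n := n) hpq hqr
  have b2 := band_mul_band' hp hpq hqr hr
  refine ⟨⟨⟨_, hy'⟩, ⟨_, hz'⟩, e2, b2, h1, ?_, fun w hw i j => ?_⟩,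
    ⟨⟨_, hy'⟩, ⟨_, hx'⟩, e1, b1, h1, ?_, fun w hw i j => ?_⟩,
    ⟨⟨_, hz'⟩, ⟨_, hx'⟩, e2.symm.trans e1, b2.symm.trans b1, ?_, ?_, fun w hw i j => ?_⟩⟩
  · exact e2 ▸ h2
  · exact tr_mul_tr_pre hp hpq hqr hr hw ((tr_pre_iff hqr hr).mp i)
      ((tr_pre_iff hpq (by omega)).mp j)
  · exact e1 ▸ h3
  · have i := (tr_pre_iff hqr hr).mp i
    exact tr_mul_tr_pre hp hpq hqr hr hw i
      (i.symm.trans ((tr_pre_iff (hpq.trans hqr) hr).mp j))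
  · exact e2 ▸ h2
  · exact e1 ▸ h3
  · have i := (tr_pre_iff hpq (hqr.le.trans hr)).mp i
    have := tr_mul_tr_pre hp hpq hqr hr hw
      (((tr_pre_iff (hpq.trans hqr) hr).mp j).trans i.symm) i
    exact e2 ▸ this

/-- Chords without common end points that do not cross. -/
def Noncrossing (p q x y : ℕ) : Prop :=
  (p < x ∧ x < q ↔ p < y ∧ y < q) ∧ (x ≠ p ∧ x ≠ q) ∧ y ≠ p ∧ y ≠ q

theorem tr_noncrossing {x y : ℕ} (hp : 1 ≤ p) (hpq : p < q) (hq : q ≤ n) (hxy : x < y)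
    (hy : y ≤ n) (h : Noncrossing p q x y) :
    tr n q p * tr n y x = tr n y x * tr n q p ∧ Pr (tr n q p) (tr n q p * tr n y x) ∧
      ∀ w, Pr w (cyc n n) → Pr (tr n q p) w → Pr (tr n y x) w → Pr (tr n q p * tr n y x) w := by
  obtain ⟨h1, ⟨h2, h3⟩, h4, h5⟩ := h
  have vp : (pt n p).val = p := pt_val (by omega)
  have vq : (pt n q).val = q := pt_val (by omega)
  have vx : (pt n x).val = x := pt_val (by omega)
  have vy : (pt n y).val = y := pt_val (by omega)
  have hne : ∀ i j, i ≤ n → j ≤ n → i ≠ j → pt n i ≠ pt n j := fun i j hi hj hij e =>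
    hij (by rw [← pt_val hi, ← pt_val hj, e])
  have n1 := hne x p (by omega) (by omega) h2
  have n2 := hne x q (by omega) (by omega) h3
  have n3 := hne y p (by omega) (by omega) h4
  have n4 := hne y q (by omega) (by omega) h5
  refine ⟨?_, ?_, fun w hw i j => ?_⟩
  · rw [tr, tr, mul_swap_eq_swap_mul, swap_apply_of_ne_of_ne n4 n3, swap_apply_of_ne_of_ne n2 n1]
  · refine (tr_pre_iff hpq hq).mpr ?_
    have e : (tr n q p * tr n y x) (pt n q) = pt n p := by
      rw [Perm.mul_apply, tr, tr, swap_apply_of_ne_of_ne n4.symm n2.symm, swap_apply_left]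
    conv_rhs => rw [← e]
    exact sameCycle_apply_right.mpr (SameCycle.refl _ _)
  · refine noncrossing_pre hw (pt_pos hp (by omega)) (pt_lt hpq hq) (pt_lt hxy hy).ne' ?_
      ⟨n1, n2⟩ ⟨n3, n4⟩ ((tr_pre_iff hpq hq).mp i) ((tr_pre_iff hxy hy).mp j)
    simp only [Set.mem_Ioo, Fin.lt_def, vp, vq, vx, vy]
    exact h1

theorem adj_noncrossing (x y : BandIndex n) (h : Noncrossing x.1.2 x.1.1 y.1.2 y.1.1)
    (h' : Noncrossing y.1.2 y.1.1 x.1.2 x.1.1) (hc : Commute (bandOf x) (bandOf y)) : BAdj x y := by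
  have h1 := tr_noncrossing x.2.1 x.2.2.1 x.2.2.2 y.2.2.1 y.2.2.2 h
  have h2 := tr_noncrossing y.2.1 y.2.2.1 y.2.2.2 x.2.2.1 x.2.2.2 h'
  exact ⟨y, x, h1.1, hc, h1.2.1, h2.2.1, h1.2.2⟩

/-- Two band generators are adjacent or linked by a third one. -/
def Linked (x y : BandIndex n) : Prop :=
  BAdj x y ∨ ∃ z, BAdj x z ∧ BAdj z y ∧
    ∀ w, Pr w (cyc n n) → Pr (bandPerm x) w → Pr (bandPerm y) w → Pr (bandPerm z) w

theorem Linked.symm {x y : BandIndex n} (h : Linked x y) : Linked y x := by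
  obtain h | ⟨z, h1, h2, h3⟩ := h
  · exact Or.inl h.symm
  · exact Or.inr ⟨z, h2.symm, h1.symm, fun w hw i j => h3 w hw j i⟩

theorem linked_of_top_lt (x y : BandIndex n) (h : x.1.1 < y.1.1) : Linked x y := by
  obtain ⟨⟨t, s⟩, hs, hst, ht⟩ := x
  obtain ⟨⟨t', s'⟩, hs', hst', ht'⟩ := y
  dsimp only at hs hst ht hs' hst' ht' h
  rcases lt_trichotomy t s' with h1 | rfl | h1
  · refine Or.inl (adj_noncrossing _ _ ?_ ?_ (band_commute_of_disjoint hst h1 hst').symm) <;>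
      (dsimp only [Noncrossing]; omega)
  · exact Or.inl (adj_triangle hs hst hst' ht' ⟨(t', t), hs', hst', ht'⟩ ⟨(t, s), hs, hst, ht⟩
      ⟨(t', s), hs, hst.trans hst', ht'⟩ rfl rfl rfl).1.symm
  rcases lt_trichotomy s s' with h2 | rfl | h2
  -- The crossing case `s < s' < t < t'`: the chord joining the two lower ends forms a triangle with
  -- either chord and lies below every noncrossing `w` above both.
  · refine Or.inr ⟨⟨(s', s), hs, h2, h1.le.trans ht⟩, ?_, ?_, fun w hw i j => ?_⟩
    · exact (adj_triangle hs h2 h1 ht ⟨(t, s'), hs', h1, ht⟩ ⟨(s', s), hs, h2, h1.le.trans ht⟩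
        ⟨(t, s), hs, hst, ht⟩ rfl rfl rfl).2.2.symm
    · exact (adj_triangle hs h2 hst' ht' ⟨(t', s'), hs', hst', ht'⟩
        ⟨(s', s), hs, h2, h1.le.trans ht⟩ ⟨(t', s), hs, hst.trans h, ht'⟩ rfl rfl rfl).1.symm
    · exact (tr_pre_iff h2 (h1.le.trans ht)).mpr (sameCycle_of_crossing hw
        (pt_pos hs (by omega)) (pt_lt h2 (by omega)) (pt_lt h1 ht) (pt_lt h ht')
        ((tr_pre_iff hst ht).mp i) ((tr_pre_iff hst' ht').mp j))
  · exact Or.inl (adj_triangle hs hst h ht' ⟨(t', t), hs.trans hst.le, h, ht'⟩ ⟨(t, s), hs, hst, ht⟩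
      ⟨(t', s), hs', hst', ht'⟩ rfl rfl rfl).2.2
  · refine Or.inl (adj_noncrossing _ _ ?_ ?_ (band_commute_of_nested hs' h2 hst h ht').symm) <;>
      (dsimp only [Noncrossing]; omega)

theorem linked_of_bot_lt (x y : BandIndex n) (h : x.1.1 = y.1.1) (h' : x.1.2 < y.1.2) :
    Linked x y := by
  obtain ⟨⟨t, s⟩, hs, hst, ht⟩ := x
  obtain ⟨⟨t', s'⟩, hs', hst', ht'⟩ := y
  dsimp only at hs hst ht hs' hst' ht' h h'
  subst h
  exact Or.inl (adj_triangle hs h' hst' ht' ⟨(t, s'), hs', hst', ht'⟩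
    ⟨(s', s), hs, h', hst'.le.trans ht⟩ ⟨(t, s), hs, hst, ht⟩ rfl rfl rfl).2.1.symm

theorem linked (x y : BandIndex n) (h : x ≠ y) : Linked x y := by
  rcases lt_trichotomy x.1.1 y.1.1 with h1 | h1 | h1
  · exact linked_of_top_lt x y h1
  · rcases lt_trichotomy x.1.2 y.1.2 with h2 | h2 | h2
    · exact linked_of_bot_lt x y h1 h2
    · exact absurd (Subtype.ext (Prod.ext h1 h2)) h
    · exact (linked_of_bot_lt y x h1.symm h2).symm
  · exact (linked_of_top_lt y x h1).symm

end Pairs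

/-- The interval of noncrossing permutations, with the band generators as lifts of its atoms. -/
theorem atomicInterval :
    (permLength (Fin (n + 1))).AtomicInterval (cyc n n) bandPerm (bandOf (n := n)) where
  len_atom p := reflLen_swap (pt_lt p.2.2.1 p.2.2.2).ne'
  atom_pre p := tr_pre_cyc p.2.1 p.2.2.1 p.2.2.2
  exists_atom x hx h1 := by
    obtain ⟨i, hi⟩ : ∃ i, x i ≠ i := by
      by_contra! h
      exact h1 (Equiv.ext h)
    have key : ∀ i j : Fin (n + 1), i < j → SameCycle x j i →
        ∃ p : BandIndex n, Pr (bandPerm p) x := fun i j hij h => by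
      have hji := (swap_pre_iff hij.ne').mpr h
      -- The long cycle fixes `0`, so no prefix of it can move `0`.
      have hi : 0 < i := by
        rcases (Fin.zero_le i).eq_or_lt with rfl | h0
        · exact absurd ((swap_pre_iff hij.ne').mp (hji.trans hx)).symm (not_sameCycle_cyc_zero hij)
        · exact h0
      have e : ∀ k : Fin (n + 1), pt n k.val = k := fun k =>
        Fin.ext (pt_val (Nat.lt_succ_iff.mp k.isLt))
      refine ⟨⟨(j.val, i.val), hi, hij, Nat.lt_succ_iff.mp j.isLt⟩, ?_⟩
      rw [bandPerm, tr, e, e]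
      exact hji
    have hc : SameCycle x i (x i) := sameCycle_apply_right.mpr (SameCycle.refl _ _)
    rcases lt_or_gt_of_ne hi with h | h
    · exact key _ _ h hc
    · exact key _ _ h hc.symm
  pair := linked

end BandBraid

/-! ### Homomorphisms out of the braid group and simple braids -/

namespace BandBraid
open Equiv Equiv.Perm LengthFn

variable {n : ℕ}

local notation "Pr" => LengthFn.Pre (permLength (Fin (n + 1)))

section Hom
variable {K : Type*} [Group K] (E : Perm (Fin (n + 1)) → K)
  (hE : ∀ x y, (permLength (Fin (n + 1))).Pre x (x * y) →
    (permLength (Fin (n + 1))).Pre (x * y) (cyc n n) → E (x * y) = E x * E y)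
include hE

theorem map_tr_mul_tr {p q r : ℕ} (hp : 1 ≤ p) (hpq : p < q) (hqr : q < r) (hr : r ≤ n) :
    E (tr n r q) * E (tr n q p) = E (tr n r p) * E (tr n r q) ∧
      E (tr n r q) * E (tr n q p) = E (tr n q p) * E (tr n r p) := by
  obtain ⟨h1, h2, h3⟩ := tr_pre_triangle hpq hqr hr
  have hc := tr_mul_tr_pre_cyc hp hpq hqr hr
  have e1 := tr_mul_tr hpq hqr hr
  have e2 := tr_mul_tr' hpq hqr hr
  rw [← hE _ _ h1 hc, ← hE _ _ (e1 ▸ h3) (e1 ▸ hc), ← hE _ _ (e2 ▸ h2) (e2 ▸ hc), ← e1, ← e2]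
  exact ⟨rfl, rfl⟩

theorem map_tr_comm {i j : ℕ} (hi : 1 ≤ i) (hij : i + 1 < j) (hj : j < n) :
    E (tr n (j + 1) j) * E (tr n (i + 1) i) = E (tr n (i + 1) i) * E (tr n (j + 1) j) := by
  have h1 := tr_noncrossing (n := n) (p := j) (q := j + 1) (x := i) (y := i + 1) (by omega)
    (by omega) (by omega) (by omega) (by omega) (by dsimp only [Noncrossing]; omega)
  have h2 := tr_noncrossing (n := n) (p := i) (q := i + 1) (x := j) (y := j + 1) (by omega)
    (by omega) (by omega) (by omega) (by omega) (by dsimp only [Noncrossing]; omega)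
  have c1 := tr_pre_cyc (n := n) (s := j) (t := j + 1) (by omega) (by omega) (by omega)
  have c2 := tr_pre_cyc (n := n) (s := i) (t := i + 1) (by omega) (by omega) (by omega)
  rw [← hE _ _ h1.2.1 (h1.2.2 _ (pre_refl _) c1 c2), ← hE _ _ h2.2.1 (h2.2.2 _ (pre_refl _) c2 c1),
    h1.1]

/-- Apply the two triangle relations in turn: `σ_{i+1} σ_i σ_{i+1} = σ_i a_{(i+2)i} σ_{i+1} = σ_i
σ_{i+1} σ_i`. -/
theorem map_tr_braid {i : ℕ} (hi : 1 ≤ i) (hn : i + 1 < n) :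
    E (tr n (i + 2) (i + 1)) * E (tr n (i + 1) i) * E (tr n (i + 2) (i + 1)) =
      E (tr n (i + 1) i) * E (tr n (i + 2) (i + 1)) * E (tr n (i + 1) i) := by
  obtain ⟨h1, h2⟩ := map_tr_mul_tr E hE hi (Nat.lt_succ_self i) (Nat.lt_succ_self (i + 1)) hn
  rw [h2, mul_assoc, ← h1, mul_assoc]

theorem artin_relations (a : FreeGroup (ArtinIndex n)) (ha : a ∈ artinRelators n) :
    FreeGroup.lift (fun i : ArtinIndex n => E (tr n (i.1 + 1) i.1)) a = 1 := by
  rcases ha with ⟨⟨t, ht⟩, ⟨s, hs⟩, h, rfl⟩ | ⟨⟨t, ht⟩, ⟨s, hs⟩, h, rfl⟩ <;>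
    simp only [map_mul, map_inv, FreeGroup.lift_apply_of, mul_inv_eq_one]
  · rcases lt_abs.mp h with h | h
    · exact map_tr_comm E hE hs.1 (by dsimp only at h; omega) ht.2
    · exact (map_tr_comm E hE ht.1 (by dsimp only at h; omega) hs.2).symm
  · rcases (abs_eq zero_le_one).mp h with h | h
    · obtain rfl : t = s + 1 := by dsimp only at h; omega
      exact map_tr_braid E hE hs.1 ht.2
    · obtain rfl : s = t + 1 := by dsimp only at h; omega
      exact (map_tr_braid E hE ht.1 hs.2).symm

/-- The homomorphism from the braid group extending a partially multiplicative map. -/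
def braidHom : Braid n →* K := PresentedGroup.toGroup (artin_relations E hE)

theorem braidHom_band {t s : ℕ} (hs : 1 ≤ s) (hst : s < t) (ht : t ≤ n) :
    braidHom E hE (band n t s) = E (tr n t s) := by
  have hsig : ∀ i, 1 ≤ i → i < n → braidHom E hE (sigma n i) = E (tr n (i + 1) i) :=
    fun i h1 h2 => by
      rw [sigma, dif_pos ⟨h1, h2⟩]
      exact PresentedGroup.toGroup.of _
  induction t, hst using Nat.le_induction with
  | base => rw [band_succ_self, hsig s hs ht]
  | succ t hst ih =>
    rw [band_succ hst, map_mul, map_mul, map_inv, ih (by omega), hsig t (by omega) ht,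
      (map_tr_mul_tr E hE hs hst (Nat.lt_succ_self t) ht).1, mul_inv_cancel_right]

end Hom

/-- The simple braid of a noncrossing permutation. -/
noncomputable def simple (x : Perm (Fin (n + 1))) : Braid n :=
  (permLength (Fin (n + 1))).lift bandPerm bandOf x

theorem simple_mul {x y : Perm (Fin (n + 1))} (h : Pr x (x * y)) (hc : Pr (x * y) (cyc n n)) :
    simple (x * y) = simple x * simple y := atomicInterval.lift_mul h hc

theorem simple_mul_inv_mul {x y : Perm (Fin (n + 1))} (h : Pr x y) (hc : Pr y (cyc n n)) :
    simple x * simple (x⁻¹ * y) = simple y := by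
  have := simple_mul (x := x) (y := x⁻¹ * y) (by simpa using h) (by simpa using hc)
  rw [mul_inv_cancel_left] at this
  exact this.symm

theorem simple_one : simple (1 : Perm (Fin (n + 1))) = 1 := atomicInterval.lift_one

theorem braidHom_simple {K : Type*} [Group K] (E : Perm (Fin (n + 1)) → K)
    (hE : ∀ x y, (permLength (Fin (n + 1))).Pre x (x * y) →
    (permLength (Fin (n + 1))).Pre (x * y) (cyc n n) → E (x * y) = E x * E y) (h1 : E 1 = 1)
    {x : Perm (Fin (n + 1))} (hx : Pr x (cyc n n)) : braidHom E hE (simple x) = E x := by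
  obtain ⟨w, rfl, hl, hw⟩ := (atomicInterval (n := n)).exists_word_lift hx
  rw [simple, ← hw]
  clear hw
  induction w with
  | nil => simp [h1]
  | cons p w ih =>
    obtain ⟨h2, h3⟩ := (atomicInterval (n := n)).pre_of_reduced_cons hl.symm
    rw [List.map_cons, List.prod_cons] at hx
    have hb := braidHom_band E hE p.2.1 p.2.2.1 p.2.2.2
    rw [List.map_cons, List.prod_cons, List.map_cons, List.prod_cons, map_mul,
      ih (h3.right_pre.trans hx) h2.symm, hE _ _ h3 hx]
    congr 1

/-- The permutation of a braid. -/
def braidPerm : Braid n →* Perm (Fin (n + 1)) := braidHom id fun _ _ _ _ => rfl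

theorem braidPerm_simple {x : Perm (Fin (n + 1))} (hx : Pr x (cyc n n)) :
    braidPerm (simple x) = x := braidHom_simple id _ rfl hx

theorem simple_injective {x y : Perm (Fin (n + 1))} (hx : Pr x (cyc n n)) (hy : Pr y (cyc n n))
    (h : simple x = simple y) : x = y := by
  rw [← braidPerm_simple hx, h, braidPerm_simple hy]

/-- Each transposition put in front raises the reflection length by one, so the defining word of `δ`
is reduced and `simple` is multiplicative along it. -/
theorem cyc_pre {m : ℕ} (hm : 1 ≤ m) (hmn : m ≤ n) : Pr (cyc n m) (cyc n n) ∧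
    ((List.Ico 1 m).reverse.map fun i => band n (i + 1) i).prod = simple (cyc n m) := by
  have step : ∀ m, 1 ≤ m → m + 1 ≤ n → Pr (tr n (m + 1) m) (tr n (m + 1) m * cyc n m) :=
    fun m hm hmn => by
      rw [pre_mul_iff]
      change reflLen (swap _ _ * cyc n m) = reflLen (swap _ _) + reflLen (cyc n m)
      rw [← cyc_succ n m hm, reflLen_cyc m hm (by omega), reflLen_cyc (m + 1) (by omega) hmn,
        reflLen_swap (pt_lt (Nat.lt_succ_self m) hmn).ne']
      omega
  have hpre : ∀ k m, 1 ≤ m → m + k = n → Pr (cyc n m) (cyc n n) := fun k => by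
    induction k with
    | zero =>
      intro m _ h
      obtain rfl : m = n := h
      exact pre_refl _
    | succ k ih =>
      intro m hm h
      have := ih (m + 1) (by omega) (by omega)
      rw [cyc_succ n m hm] at this
      exact (step m hm (by omega)).right_pre.trans this
  refine ⟨hpre (n - m) m hm (by omega), ?_⟩
  induction m, hm using Nat.le_induction with
  | base =>
    have : cyc n 1 = 1 := by simp [cyc]
    simp [this, simple_one]
  | succ m hm ih =>
    have e : (List.Ico 1 (m + 1)).reverse = m :: (List.Ico 1 m).reverse := by
      rw [List.Ico.succ_top hm]
      simp
    have hc := hpre (n - (m + 1)) (m + 1) (by omega) (by omega)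
    rw [e, List.map_cons, List.prod_cons, ih (by omega), cyc_succ n m hm]
    rw [cyc_succ n m hm] at hc
    have h1 : simple (tr n (m + 1) m) = band n (m + 1) m :=
      atomicInterval.lift_atom ⟨(m + 1, m), hm, Nat.lt_succ_self m, hmn⟩
    rw [← h1]
    exact (simple_mul (step m hm hmn) hc).symm

theorem delta_eq_simple (hn : 1 ≤ n) : delta n = simple (cyc n n) := (cyc_pre hn le_rfl).2

theorem cyc_ne_one (hn : 2 ≤ n) : cyc n n ≠ 1 := fun h => by
  have := reflLen_cyc (n := n) n (by omega) le_rfl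
  rw [h, reflLen_one] at this
  omega

/-- The meet operation on noncrossing permutations. -/
noncomputable def meetInterval (hn : 2 ≤ n) : (permLength (Fin (n + 1))).MeetInterval (cyc n n) :=
  open Classical in
  have key : ∀ x y, Pr x (cyc n n) → Pr y (cyc n n) → ∃ z, Pr z x ∧ Pr z y ∧
      ∀ w, Pr w x → Pr w y → Pr w z := fun _ _ hx hy => (atomicInterval (n := n)).exists_meet hx hy
  { inf := fun x y => if h : Pr x (cyc n n) ∧ Pr y (cyc n n) then (key x y h.1 h.2).choose else 1
    inf_left := fun {x y} hx hy => by
      rw [dif_pos ⟨hx, hy⟩]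
      exact (key x y hx hy).choose_spec.1
    inf_right := fun {x y} hx hy => by
      rw [dif_pos ⟨hx, hy⟩]
      exact (key x y hx hy).choose_spec.2.1
    pre_inf := fun {x y w} hx hy => by
      rw [dif_pos ⟨hx, hy⟩]
      exact (key x y hx hy).choose_spec.2.2 w
    ne_one := cyc_ne_one hn }

theorem band_mem_positive (p : BandIndex n) : bandOf p ∈ positive n :=
  Submonoid.subset_closure ⟨p, rfl⟩

theorem simple_mem_positive {x : Perm (Fin (n + 1))} (hx : Pr x (cyc n n)) :
    simple x ∈ positive n := by
  obtain ⟨w, -, -, hw⟩ := (atomicInterval (n := n)).exists_word_lift hx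
  rw [simple, ← hw]
  refine list_prod_mem fun a ha => ?_
  obtain ⟨p, -, rfl⟩ := List.mem_map.mp ha
  exact band_mem_positive p

theorem exists_word_of_mem_positive {P : Braid n} (hP : P ∈ positive n) :
    ∃ w : PosWord n, evalWord w = P := by
  induction hP using Submonoid.closure_induction with
  | mem x hx =>
    obtain ⟨p, rfl⟩ := hx
    exact ⟨[p], by simp [evalWord]⟩
  | one => exact ⟨[], rfl⟩
  | mul x y _ _ hx hy =>
    obtain ⟨v, rfl⟩ := hx
    obtain ⟨w, rfl⟩ := hy
    exact ⟨v ++ w, by simp [evalWord]⟩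

theorem one_le_iff {A : Braid n} : Le 1 A ↔ A ∈ positive n := by
  constructor
  · rintro ⟨P, hP, Q, hQ, rfl⟩
    rw [mul_one]
    exact mul_mem hP hQ
  · exact fun h => ⟨A, h, 1, one_mem _, by simp⟩

theorem wordLength_simple {x : Perm (Fin (n + 1))} (hx : Pr x (cyc n n)) :
    wordLength (simple x) = reflLen x := by
  obtain ⟨w, -, hl, hw⟩ := (atomicInterval (n := n)).exists_word_lift hx
  rw [simple, ← hw]
  exact (wordLength_evalWord w).trans hl

theorem braidPerm_evalWord (w : PosWord n) : braidPerm (evalWord w) = (w.map bandPerm).prod := by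
  rw [evalWord, map_list_prod, List.map_map]
  congr 1
  exact List.map_congr_left fun p _ => braidHom_band id _ p.2.1 p.2.2.1 p.2.2.2

/-- The braids between `e` and `δ` are the simple ones. -/
theorem inUnitInterval_iff (hn : 1 ≤ n) {A : Braid n} :
    InUnitInterval A ↔ ∃ x, Pr x (cyc n n) ∧ simple x = A := by
  constructor
  · rintro ⟨h1, P, hP, Q, hQ, h⟩
    obtain ⟨w, rfl⟩ := exists_word_of_mem_positive (one_le_iff.mp h1)
    obtain ⟨v₁, rfl⟩ := exists_word_of_mem_positive hP
    obtain ⟨v₂, rfl⟩ := exists_word_of_mem_positive hQ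
    obtain ⟨d, -, hdl, hd⟩ := (atomicInterval (n := n)).exists_word_lift (pre_refl (cyc n n))
    have hd' : evalWord d = evalWord v₁ * evalWord w * evalWord v₂ :=
      hd.trans ((delta_eq_simple hn).symm.trans h)
    -- The exponent sum shows that the word `v₁ w v₂` for `δ` has the length of `c`. Subadditivity
    -- then forces its image, and each of its pieces, to be reduced.
    have hlen : d.length = v₁.length + w.length + v₂.length := by
      have := congrArg (expSum n) hd'
      rw [map_mul, map_mul, expSum_evalWord, expSum_evalWord, expSum_evalWord, expSum_evalWord,
        ← ofAdd_add, ← ofAdd_add] at this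
      exact_mod_cast Multiplicative.ofAdd.injective this
    have hp : cyc n n =
        (v₁.map bandPerm).prod * ((w.map bandPerm).prod * (v₂.map bandPerm).prod) := by
      rw [← braidPerm_evalWord, ← braidPerm_evalWord, ← braidPerm_evalWord, ← mul_assoc, ← map_mul,
        ← map_mul, ← h, delta_eq_simple hn, braidPerm_simple (pre_refl _)]
    have l1 := (atomicInterval (n := n)).len_prod_le v₁
    have l2 := (atomicInterval (n := n)).len_prod_le w
    have l3 := (atomicInterval (n := n)).len_prod_le v₂
    have l4 := LengthFn.len_mul_le (permLength (Fin (n + 1))) (v₁.map bandPerm).prod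
      ((w.map bandPerm).prod * (v₂.map bandPerm).prod)
    have l5 := LengthFn.len_mul_le (permLength (Fin (n + 1))) (w.map bandPerm).prod
      (v₂.map bandPerm).prod
    have l6 := hdl
    rw [hp] at l6
    have hc1 : Pr (v₁.map bandPerm).prod (cyc n n) := by
      rw [hp, pre_mul_iff]
      omega
    have hc2 : Pr (w.map bandPerm).prod ((w.map bandPerm).prod * (v₂.map bandPerm).prod) := by
      rw [pre_mul_iff]
      omega
    have hc3 := hc1.inv_mul_pre
    rw [hp, inv_mul_cancel_left, ← hp] at hc3
    exact ⟨_, hc2.trans hc3, (atomicInterval (n := n)).lift_prod (by omega) (hc2.trans hc3)⟩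
  · rintro ⟨x, hx, rfl⟩
    refine ⟨one_le_iff.mpr (simple_mem_positive hx), 1, one_mem _, simple (x⁻¹ * cyc n n),
      simple_mem_positive hx.inv_mul_pre, ?_⟩
    rw [one_mul, simple_mul_inv_mul hx (pre_refl _), delta_eq_simple hn]

theorem isCanonicalFactor_iff (hn : 1 ≤ n) {A : Braid n} :
    IsCanonicalFactor A ↔ ∃ x, (Pr x (cyc n n) ∧ x ≠ 1 ∧ x ≠ cyc n n) ∧ simple x = A := by
  have h0 : IsCanonicalFactor A ↔ InUnitInterval A ∧ 1 ≠ A ∧ A ≠ delta n := by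
    unfold IsCanonicalFactor Lt InUnitInterval
    tauto
  rw [h0, inUnitInterval_iff hn]
  constructor
  · rintro ⟨⟨x, hx, rfl⟩, h1, h2⟩
    refine ⟨x, ⟨hx, ?_, ?_⟩, rfl⟩
    · rintro rfl
      exact h1 simple_one.symm
    · rintro rfl
      exact h2 (delta_eq_simple hn).symm
  · rintro ⟨x, ⟨hx, h1, h2⟩, rfl⟩
    refine ⟨⟨x, hx, rfl⟩, fun h => h1 ?_, fun h => h2 ?_⟩
    · exact simple_injective hx (one_pre _) (h.symm.trans simple_one.symm)
    · exact simple_injective hx (pre_refl _) (h.trans (delta_eq_simple hn))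

end BandBraid

/-! ### Existence of normal forms of braids -/

namespace BandBraid
open Equiv Equiv.Perm LengthFn LengthFn.MeetInterval

variable {n : ℕ}

local notation "Pr" => LengthFn.Pre (permLength (Fin (n + 1)))
local notation "Nrm" => LengthFn.Normal (permLength (Fin (n + 1))) (cyc n n)

section Positive

/-- With `x' = x⁻¹ c` and `x'' = x'⁻¹ c = c⁻¹ x c`, the braid `δ` equals both `x x'` and `x' x''`,
so `x δ = x x' x'' = δ x''`. -/
theorem delta_mul_simple_conj {x : Perm (Fin (n + 1))} (hn : 1 ≤ n) (hx : Pr x (cyc n n)) :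
    simple x * delta n = delta n * simple ((cyc n n)⁻¹ * x * cyc n n) := by
  have h := simple_mul_inv_mul hx (pre_refl _)
  have h' := simple_mul_inv_mul hx.inv_mul_pre (pre_refl _)
  rw [show (x⁻¹ * cyc n n)⁻¹ * cyc n n = (cyc n n)⁻¹ * x * cyc n n by group] at h'
  rw [delta_eq_simple hn]
  conv_lhs => rw [← h', ← mul_assoc, h]

theorem simple_mul_delta_zpow (hn : 1 ≤ n) (u : ℤ) {x : Perm (Fin (n + 1))}
    (hx : Pr x (cyc n n)) :
    simple x * delta n ^ u = delta n ^ u * simple (cyc n n ^ (-u) * x * cyc n n ^ u) := by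
  induction u using Int.induction_on with
  | zero => simp
  | succ u ih =>
    have h := delta_mul_simple_conj hn (hx.conj_pow (u : ℤ))
    rw [zpow_add_one, ← mul_assoc, ih, mul_assoc, h, ← mul_assoc]
    congr 2
    group
  | pred u ih =>
    have h := delta_mul_simple_conj hn (hx.conj_pow (-u - 1 : ℤ))
    rw [show (cyc n n)⁻¹ * (cyc n n ^ (-(-u - 1 : ℤ)) * x * cyc n n ^ (-u - 1 : ℤ)) * cyc n n =
      cyc n n ^ (-(-u : ℤ)) * x * cyc n n ^ (-u : ℤ) by group] at h
    rw [zpow_sub_one, ← mul_assoc, ih, mul_inv_eq_iff_eq_mul, mul_assoc _ (simple _) (delta n), h]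
    group

theorem conj_mem_positive (hn : 1 ≤ n) (u : ℤ) {P : Braid n} (hP : P ∈ positive n) :
    delta n ^ (-u) * P * delta n ^ u ∈ positive n := by
  induction hP using Submonoid.closure_induction with
  | mem x hx =>
    obtain ⟨p, rfl⟩ := hx
    have h : simple (bandPerm p) = band n p.1.1 p.1.2 := atomicInterval.lift_atom p
    have hp : Pr (bandPerm p) (cyc n n) := atomicInterval.atom_pre p
    rw [mul_assoc]
    dsimp only
    rw [← h, simple_mul_delta_zpow hn u hp, ← mul_assoc, ← zpow_add, neg_add_cancel, zpow_zero,
      one_mul]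
    exact simple_mem_positive (hp.conj_pow u)
  | one => simp
  | mul x y _ _ hx hy =>
    have := mul_mem hx hy
    rwa [show delta n ^ (-u) * x * delta n ^ u * (delta n ^ (-u) * y * delta n ^ u) =
      delta n ^ (-u) * (x * y) * delta n ^ u by group] at this

variable (hn : 2 ≤ n)
include hn

theorem simple_prod_ins {y : Perm (Fin (n + 1))} (hy : Pr y (cyc n n))
    {L : List (Perm (Fin (n + 1)))} (hL : Nrm L) :
    (((meetInterval hn).ins y L).map simple).prod = simple y * (L.map simple).prod :=
  (meetInterval hn).prod_map_ins (fun _ _ => simple_mul) simple_one hy hL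

/-- Every positive braid is the product of a normal sequence. -/
theorem exists_normal_of_mem_positive {P : Braid n} (hP : P ∈ positive n) :
    ∃ L, Nrm L ∧ (L.map simple).prod = P := by
  obtain ⟨w, rfl⟩ := exists_word_of_mem_positive hP
  induction w with
  | nil => exact ⟨[], normal_nil, rfl⟩
  | cons p w ih =>
    obtain ⟨L, hL, h⟩ := ih (by
      refine list_prod_mem fun a ha => ?_
      obtain ⟨p, -, rfl⟩ := List.mem_map.mp ha
      exact band_mem_positive p)
    have hp : Pr (bandPerm p) (cyc n n) := atomicInterval.atom_pre p
    refine ⟨_, (meetInterval hn).normal_ins hp hL, ?_⟩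
    rw [simple_prod_ins hn hp hL, h]
    have h1 : simple (bandPerm p) = bandOf p := atomicInterval.lift_atom p
    rw [h1]
    simp [evalWord, bandOf]

theorem exists_normal_form (W : Braid n) :
    ∃ (u : ℤ) (L : List (Perm (Fin (n + 1)))), Nrm L ∧ W = delta n ^ u * (L.map simple).prod := by
  have hn1 : 1 ≤ n := by omega
  have step : ∀ x, Pr x (cyc n n) → ∀ W : Braid n,
      (∃ (u : ℤ) (L : List _), Nrm L ∧ W = delta n ^ u * (L.map simple).prod) →
      ∃ (u : ℤ) (L : List _), Nrm L ∧ simple x * W = delta n ^ u * (L.map simple).prod := by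
    rintro x hx _ ⟨u, L, hL, rfl⟩
    refine ⟨u, _, (meetInterval hn).normal_ins (hx.conj_pow u) hL, ?_⟩
    rw [simple_prod_ins hn (hx.conj_pow u) hL, ← mul_assoc, ← mul_assoc,
      simple_mul_delta_zpow hn1 u hx]
  have hW : W ∈ Subgroup.closure (Set.range (PresentedGroup.of (rels := artinRelators n))) := by
    rw [PresentedGroup.closure_range_of]
    trivial
  have hof : ∀ i : ArtinIndex n, PresentedGroup.of i = simple (tr n (i.1 + 1) i.1) := by
    rintro ⟨i, hi⟩
    have h1 : simple (tr n (i + 1) i) = band n (i + 1) i :=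
      atomicInterval.lift_atom ⟨(i + 1, i), hi.1, Nat.lt_succ_self i, hi.2⟩
    rw [h1, band_succ_self, sigma, dif_pos hi]
  have hpre : ∀ i : ArtinIndex n, Pr (tr n (i.1 + 1) i.1) (cyc n n) := fun i =>
    tr_pre_cyc i.2.1 (Nat.lt_succ_self _) i.2.2
  induction hW using Subgroup.closure_induction_left with
  | one => exact ⟨0, [], normal_nil, by simp⟩
  | mul_left x hx y _ ih =>
    obtain ⟨i, rfl⟩ := hx
    rw [hof]
    exact step _ (hpre i) y ih
  | inv_mul_cancel x hx y _ ih =>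
    obtain ⟨i, rfl⟩ := hx
    obtain ⟨u, L, hL, h⟩ := step _ (hpre i).mul_inv_pre y ih
    -- `σ_i⁻¹` is `δ⁻¹` times the simple braid of the left complement of its transposition.
    refine ⟨-1 + u, L, hL, ?_⟩
    have e : simple (cyc n n * (tr n (i.1 + 1) i.1)⁻¹) * simple (tr n (i.1 + 1) i.1) =
        delta n := by
      rw [← simple_mul] <;> rw [inv_mul_cancel_right]
      · rw [delta_eq_simple hn1]
      · exact (hpre i).mul_inv_pre
      · exact pre_refl _
    rw [zpow_add, mul_assoc, ← h, ← e, zpow_neg_one, hof]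
    group

end Positive

/-! ### Uniqueness through the action, and the values of inf and sup -/

section Action
variable (hn : 2 ≤ n)

open Classical in
/-- The action of the braid group on normal forms. -/
noncomputable def normalFormHom : Braid n →* Perm (NF (permLength (Fin (n + 1))) (cyc n n)) :=
  braidHom (fun x => if hx : Pr x (cyc n n) then (meetInterval hn).actPerm x hx else 1)
    fun x y h hc => by
      rw [dif_pos hc, dif_pos (h.trans hc), dif_pos (h.right_pre.trans hc)]
      exact (meetInterval hn).actPerm_mul h hc

theorem normalFormHom_simple {x : Perm (Fin (n + 1))} (hx : Pr x (cyc n n))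
    (p : NF (permLength (Fin (n + 1))) (cyc n n)) :
    normalFormHom hn (simple x) p = (meetInterval hn).act x hx p := by
  rw [normalFormHom, braidHom_simple _ _ _ hx, dif_pos hx]
  · rfl
  · rw [dif_pos (one_pre _)]
    have := (meetInterval hn).actPerm_mul (x := 1) (y := 1) (one_pre _)
      (by rw [mul_one]; exact one_pre _)
    simpa using this

theorem normalFormHom_simple_toNF {x : Perm (Fin (n + 1))} (hx : Pr x (cyc n n))
    {L : List (Perm (Fin (n + 1)))} (hL : Nrm L) :
    normalFormHom hn (simple x) (toNF 0 L hL) =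
      toNF 0 ((meetInterval hn).ins x L) ((meetInterval hn).normal_ins hx hL) := by
  rw [normalFormHom_simple hn hx, act_toNF]
  exact toNF_congr rfl (by simp)

/-- A head that already fits greedily absorbs nothing, so acting on the empty form rebuilds `L`.
Uniqueness rests on this. -/
theorem normalFormHom_prod {L : List (Perm (Fin (n + 1)))} (hL : Nrm L) :
    normalFormHom hn (L.map simple).prod (toNF 0 [] normal_nil) = toNF 0 L hL := by
  induction L with
  | nil => simp
  | cons x L ih =>
    obtain ⟨⟨hx, -⟩, -, hL'⟩ := normal_cons.mp hL
    rw [List.map_cons, List.prod_cons, map_mul, Perm.mul_apply, ih hL',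
      normalFormHom_simple_toNF hn hx]
    exact toNF_congr rfl ((meetInterval hn).ins_eq_cons hL)

theorem normalFormHom_delta_zpow (u : ℤ) (p : NF (permLength (Fin (n + 1))) (cyc n n)) :
    (normalFormHom hn (delta n ^ u) p).1 = (p.1.1 + u, p.1.2) := by
  have h : normalFormHom hn (delta n) = shift _ _ := Equiv.ext fun p => by
    rw [delta_eq_simple (by omega), normalFormHom_simple hn (pre_refl _), act_top]
  rw [map_zpow, h]
  induction u using Int.induction_on generalizing p with
  | zero => simp
  | succ u ih =>
    rw [zpow_add_one, Perm.mul_apply, ih]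
    simp only [shift, Equiv.coe_fn_mk]
    ring_nf
  | pred u ih =>
    rw [zpow_sub_one, Perm.mul_apply, ih]
    change (p.1.1 - 1 + -(u : ℤ), p.1.2) = _
    ring_nf

/-- Left multiplication by a positive braid does not shorten normal sequences. -/
theorem exists_normal_mul {Q : Braid n} (hQ : Q ∈ positive n) {L : List (Perm (Fin (n + 1)))}
    (hL : Nrm L) : ∃ M, ∃ hM : Nrm M, L.length ≤ M.length ∧
      normalFormHom hn Q (toNF 0 L hL) = toNF 0 M hM := by
  induction hQ using Submonoid.closure_induction generalizing L with
  | mem x hx =>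
    obtain ⟨p, rfl⟩ := hx
    have h : simple (bandPerm p) = band n p.1.1 p.1.2 := atomicInterval.lift_atom p
    have hp : Pr (bandPerm p) (cyc n n) := atomicInterval.atom_pre p
    refine ⟨_, (meetInterval hn).normal_ins hp hL,
      (meetInterval hn).length_le_length_ins (bandPerm p) L, ?_⟩
    dsimp only
    rw [← h]
    exact normalFormHom_simple_toNF hn hp hL
  | one => exact ⟨L, hL, le_rfl, by simp⟩
  | mul x y _ _ hx hy =>
    obtain ⟨M, hM, h1, h2⟩ := hy hL
    obtain ⟨K, hK, h3, h4⟩ := hx hM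
    exact ⟨K, hK, h1.trans h3, by rw [map_mul, Perm.mul_apply, h2, h4]⟩

theorem normalFormHom_delta_zpow_mul {u : ℤ} {L : List (Perm (Fin (n + 1)))} (hL : Nrm L) :
    ∃ (a : ℕ) (L' : List (Perm (Fin (n + 1)))), L = List.replicate a (cyc n n) ++ L' ∧
      (normalFormHom hn (delta n ^ u * (L.map simple).prod) (toNF 0 [] normal_nil)).1 =
        (u + a, L') := by
  obtain ⟨a, L', h1, -, -, h2⟩ := exists_strip hL 0
  refine ⟨a, L', h1, ?_⟩
  rw [map_mul, Perm.mul_apply, normalFormHom_prod hn hL, normalFormHom_delta_zpow]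
  change ((strip _ _ _).1 + u, (strip _ _ _).2) = _
  rw [h2]
  simp [add_comm]

theorem normalFormHom_reduced {u : ℤ} {L : List (Perm (Fin (n + 1)))} (hL : Nrm L)
    (hc : cyc n n ∉ L) :
    (normalFormHom hn (delta n ^ u * (L.map simple).prod) (toNF 0 [] normal_nil)).1 = (u, L) := by
  rw [map_mul, Perm.mul_apply, normalFormHom_prod hn hL, normalFormHom_delta_zpow]
  change ((strip _ _ _).1 + u, (strip _ _ _).2) = _
  rw [strip_eq_self hc]
  simp

include hn

/-- An absorbable piece of `y` would lengthen the first factor. Conversely, given another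
decomposition, insert its first factor `x'` into a normal sequence of the rest; the action shows
that the result is `[x, y]`, and `x'` is a prefix of its head. -/
theorem leftWeighted_iff {x y : Perm (Fin (n + 1))} (hx : Pr x (cyc n n) ∧ x ≠ 1)
    (hy : Pr y (cyc n n) ∧ y ≠ 1) :
    LeftWeighted (simple x) (simple y) ↔ (permLength (Fin (n + 1))).Greedy (cyc n n) x y := by
  have hn1 : 1 ≤ n := by omega
  constructor
  · rintro ⟨-, -, h⟩ t ht1 ht2
    have hxt := hx.1.mul_pre ht1
    have hpre := hx.1.pre_mul ht1
    have := h (simple (x * t)) (simple (t⁻¹ * y)) ((inUnitInterval_iff hn1).mpr ⟨_, hxt, rfl⟩)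
      (one_le_iff.mpr (simple_mem_positive (ht2.inv_mul_pre.trans hy.1)))
      (by rw [simple_mul hpre hxt, mul_assoc, simple_mul_inv_mul ht2 hy.1])
    rw [wordLength_simple hxt, wordLength_simple hx.1] at this
    have hl : reflLen (x * t) = reflLen x + reflLen t := pre_mul_iff.mp hpre
    exact eq_one_of_reflLen_eq_zero t (by omega)
  · intro h
    refine ⟨(inUnitInterval_iff hn1).mpr ⟨x, hx.1, rfl⟩, one_le_iff.mpr (simple_mem_positive hy.1),
      fun A' P' hA' hP' he => ?_⟩
    obtain ⟨x', hx', rfl⟩ := (inUnitInterval_iff hn1).mp hA'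
    obtain ⟨M, hM, rfl⟩ := exists_normal_of_mem_positive hn (one_le_iff.mp hP')
    have hxy : Nrm [x, y] := normal_cons.mpr ⟨hx, by simpa using h, normal_singleton hy.1 hy.2⟩
    have h1 := normalFormHom_prod hn hxy
    have h2 := normalFormHom_prod hn ((meetInterval hn).normal_ins hx' hM)
    rw [simple_prod_ins hn hx' hM, he] at h2
    simp only [List.map_cons, List.map_nil, List.prod_cons, List.prod_nil, mul_one] at h1
    have h3 := toNF_zero_injective _ _ (h1.symm.trans h2)
    have h4 := (meetInterval hn).exists_head_ins x' hM hx' (h := x) (by rw [← h3]; simp)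
    rw [wordLength_simple hx', wordLength_simple hx.1]
    exact h4.len_le

theorem isChain_leftWeighted_iff {L : List (Perm (Fin (n + 1)))}
    (hL : ∀ x ∈ L, Pr x (cyc n n) ∧ x ≠ 1) :
    (L.map simple).IsChain LeftWeighted ↔ Nrm L := by
  induction L with
  | nil => simp [normal_nil]
  | cons x L ih =>
    rw [List.forall_mem_cons] at hL
    rw [normal_cons, List.map_cons, List.isChain_cons, ih hL.2]
    simp only [hL.1, and_true, true_and, ne_eq, not_false_eq_true]
    refine and_congr_left fun _ => ?_
    cases L with
    | nil => simp
    | cons y L => simpa using leftWeighted_iff hn hL.1 (hL.2 y (by simp))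

/-- Left-canonical forms are the images of normal sequences that do not contain the long cycle. -/
theorem isLeftCanonicalForm_iff {W : Braid n} {u : ℤ} {L : List (Braid n)} :
    IsLeftCanonicalForm W u L ↔ ∃ L' : List (Perm (Fin (n + 1))), Nrm L' ∧ cyc n n ∉ L' ∧
      L'.map simple = L ∧ W = delta n ^ u * (L'.map simple).prod := by
  have hn1 : 1 ≤ n := by omega
  constructor
  · rintro ⟨hW, h1, h2⟩
    have h3 : ∃ L' : List (Perm (Fin (n + 1))),
        (∀ x ∈ L', Pr x (cyc n n) ∧ x ≠ 1 ∧ x ≠ cyc n n) ∧ L'.map simple = L := by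
      clear h2 hW
      induction L with
      | nil => exact ⟨[], by simp, rfl⟩
      | cons A L ih =>
        rw [List.forall_mem_cons] at h1
        obtain ⟨x, hx, rfl⟩ := (isCanonicalFactor_iff hn1).mp h1.1
        obtain ⟨L', h, rfl⟩ := ih h1.2
        exact ⟨x :: L', List.forall_mem_cons.mpr ⟨hx, h⟩, rfl⟩
    obtain ⟨L', hL', rfl⟩ := h3
    refine ⟨L', ?_, fun h => (hL' _ h).2.2 rfl, rfl, hW⟩
    exact (isChain_leftWeighted_iff hn fun x hx => ⟨(hL' x hx).1, (hL' x hx).2.1⟩).mp h2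
  · rintro ⟨L', h1, h2, rfl, hW⟩
    refine ⟨hW, fun A hA => ?_, (isChain_leftWeighted_iff hn h1.1).mpr h1⟩
    obtain ⟨x, hx, rfl⟩ := List.mem_map.mp hA
    exact (isCanonicalFactor_iff hn1).mpr
      ⟨x, ⟨(h1.1 x hx).1, (h1.1 x hx).2, fun h => h2 (h ▸ hx)⟩, rfl⟩

theorem exists_isLeftCanonicalForm (W : Braid n) : ∃ u L, IsLeftCanonicalForm W u L := by
  obtain ⟨u, L, hL, rfl⟩ := exists_normal_form hn W
  obtain ⟨a, L', rfl, h1, h2, -⟩ := exists_strip hL 0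
  refine ⟨u + a, L'.map simple, (isLeftCanonicalForm_iff hn).mpr ⟨L', h1, h2, rfl, ?_⟩⟩
  rw [List.map_append, List.prod_append, List.map_replicate, List.prod_replicate,
    ← delta_eq_simple (by omega), zpow_add, zpow_natCast, mul_assoc]

theorem isLeftCanonicalForm_unique {W : Braid n} {u v : ℤ} {L M : List (Braid n)}
    (h : IsLeftCanonicalForm W u L) (h' : IsLeftCanonicalForm W v M) : u = v ∧ L = M := by
  obtain ⟨L, h1, h2, rfl, rfl⟩ := (isLeftCanonicalForm_iff hn).mp h
  obtain ⟨M, k1, k2, rfl, k3⟩ := (isLeftCanonicalForm_iff hn).mp h'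
  have e1 := normalFormHom_reduced hn (u := u) h1 h2
  have e2 := normalFormHom_reduced hn (u := v) k1 k2
  rw [k3, e2, Prod.mk.injEq] at e1
  exact ⟨e1.1.symm, by rw [e1.2]⟩

/-- If `W = P δ^v Q`, moving `δ^v` to the front gives `W = δ^v R` with `R` positive. A normal
sequence of `R` can only add its `a ≥ 0` leading copies of `c`, so `u = v + a`. -/
theorem isGreatest_inf {W : Braid n} {u : ℤ} {L : List (Braid n)}
    (h : IsLeftCanonicalForm W u L) : IsGreatest {v : ℤ | Le (delta n ^ v) W} u := by
  obtain ⟨L, h1, h2, rfl, rfl⟩ := (isLeftCanonicalForm_iff hn).mp h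
  refine ⟨⟨1, one_mem _, (L.map simple).prod, ?_, by rw [one_mul]⟩, ?_⟩
  · refine list_prod_mem fun a ha => ?_
    obtain ⟨x, hx, rfl⟩ := List.mem_map.mp ha
    exact simple_mem_positive (h1.1 x hx).1
  · rintro v ⟨P, hP, Q, hQ, hW⟩
    have hR := mul_mem (conj_mem_positive (by omega) v hP) hQ
    obtain ⟨M, hM, hMR⟩ := exists_normal_of_mem_positive hn hR
    have e : delta n ^ u * (L.map simple).prod = delta n ^ v * (M.map simple).prod := by
      rw [hW, hMR]
      group
    obtain ⟨a, M', -, e1⟩ := normalFormHom_delta_zpow_mul hn (u := v) hM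
    rw [← e, normalFormHom_reduced hn h1 h2, Prod.mk.injEq] at e1
    omega

/-- Complete each factor to `δ` by its complement, conjugated past the power of `δ` already formed.
-/
theorem exists_mul_eq_delta_pow {L : List (Perm (Fin (n + 1)))} (hL : ∀ x ∈ L, Pr x (cyc n n)) :
    ∃ Q ∈ positive n, (L.map simple).prod * Q = delta n ^ (L.length : ℤ) := by
  have hn1 : 1 ≤ n := by omega
  induction L with
  | nil => exact ⟨1, one_mem _, by simp⟩
  | cons x L ih =>
    rw [List.forall_mem_cons] at hL
    obtain ⟨Q, hQ, h⟩ := ih hL.2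
    have hR := conj_mem_positive hn1 (L.length : ℤ) (simple_mem_positive hL.1.inv_mul_pre)
    refine ⟨_, mul_mem hQ hR, ?_⟩
    have hx := simple_mul_inv_mul hL.1 (pre_refl _)
    rw [← delta_eq_simple hn1] at hx
    calc _ = simple x * ((L.map simple).prod * Q) * (delta n ^ (-(L.length : ℤ)) *
          simple (x⁻¹ * cyc n n) * delta n ^ (L.length : ℤ)) := by
            simp only [List.map_cons, List.prod_cons, mul_assoc]
      _ = (simple x * simple (x⁻¹ * cyc n n)) * delta n ^ (L.length : ℤ) := by
            rw [h]
            group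
      _ = _ := by
            rw [hx, List.length_cons, Nat.cast_succ, ← zpow_one_add, add_comm (1 : ℤ)]

/-- If `δ^v = P W Q`, then `δ^(v-u) = R A₁ ⋯ A_k` with `R` positive. Acting by `R` on the form of
`A₁ ⋯ A_k` yields `v - u` copies of `c` and nothing else, and this sequence has at least `k`
entries. -/
theorem isLeast_sup {W : Braid n} {u : ℤ} {L : List (Braid n)}
    (h : IsLeftCanonicalForm W u L) :
    IsLeast {v : ℤ | Le W (delta n ^ v)} (u + (L.length : ℤ)) := by
  have hn1 : 1 ≤ n := by omega
  obtain ⟨L, h1, h2, rfl, rfl⟩ := (isLeftCanonicalForm_iff hn).mp h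
  rw [List.length_map]
  constructor
  · obtain ⟨Q, hQ, hL⟩ := exists_mul_eq_delta_pow hn fun x hx => (h1.1 x hx).1
    exact ⟨1, one_mem _, Q, hQ, by rw [one_mul, mul_assoc, hL, zpow_add]⟩
  · rintro v ⟨P, hP, Q, hQ, hW⟩
    have hR := conj_mem_positive hn1 u (mul_mem (conj_mem_positive hn1 (-v) hQ) hP)
    have e : delta n ^ (v - u) = delta n ^ (-u) * (delta n ^ (- -v) * Q * delta n ^ (-v) * P) *
        delta n ^ u * (L.map simple).prod := by
      have e1 : (L.map simple).prod = delta n ^ (-u) * P⁻¹ * delta n ^ v * Q⁻¹ := by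
        rw [hW]
        group
      rw [e1]
      group
    obtain ⟨M, hM, hlen, e1⟩ := exists_normal_mul hn hR h1
    obtain ⟨a, M', rfl, -, -, e2⟩ := exists_strip hM 0
    have e3 := normalFormHom_delta_zpow hn (v - u) (toNF 0 [] normal_nil)
    rw [e, map_mul, Perm.mul_apply, normalFormHom_prod hn h1, e1] at e3
    change strip _ _ _ = ((strip _ _ _).1 + _, (strip _ _ _).2) at e3
    rw [e2] at e3
    simp only [strip, zero_add, Prod.mk.injEq] at e3
    obtain ⟨e4, rfl⟩ := e3
    simp only [List.append_nil, List.length_replicate] at hlen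
    omega

end Action

end BandBraid

theorem mainTheorem1 (n : ℕ) (hn : 2 ≤ n) (W : BandBraid.Braid n) :
    (∃! p : ℤ × List (BandBraid.Braid n), BandBraid.IsLeftCanonicalForm W p.1 p.2) ∧
    ∀ (u : ℤ) (L : List (BandBraid.Braid n)), BandBraid.IsLeftCanonicalForm W u L →
      IsGreatest {v : ℤ | BandBraid.Le (BandBraid.delta n ^ v) W} u ∧
      IsLeast {v : ℤ | BandBraid.Le W (BandBraid.delta n ^ v)} (u + (L.length : ℤ)) := by
  refine ⟨?_, fun u L h => ⟨BandBraid.isGreatest_inf hn h, BandBraid.isLeast_sup hn h⟩⟩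
  obtain ⟨u, L, h⟩ := BandBraid.exists_isLeftCanonicalForm hn W
  refine ⟨(u, L), h, fun p hp => ?_⟩
  obtain ⟨h1, h2⟩ := BandBraid.isLeftCanonicalForm_unique hn hp h
  exact Prod.ext h1 h2
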